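/- Let $k\ge 4$ be an even integer. For $\kappa\in\{k,2-k\}$, $z=x+iy\in\mathbb H$ and $\operatorname{Re}(s)>1-\frac{\kappa}{2}$ put $$E_\kappa(z,s)=\frac12\sum_{(m,n)\in\mathbb Z^2\setminus\{(0,0)\}}\frac{y^s}{|mz+n|^{2s}(mz+n)^{\kappa}},$$ $$\widehat{\widehat E}_\kappa(z,s)=\Big(s+\frac \kappa2\Big)\Big(s+\frac \kappa2-1\Big)\pi^{-(s+\frac \kappa2)}\,\Gamma\Big(s+\frac \kappa2+\frac{|\kappa|}2\Big)E_\kappa(z,s).$$ For each $z$ the function $\widehat{\widehat E}_\kappa(z,s)$ extends to an entire function of $s$; write $$\widehat{\widehat E}_k(z,s)=\sum_{n\ge0}G_{n,k}(z)s^n,\qquad \widehat{\widehat E}_{2-k}(z,s)=\sum_{n\ge0}F_{n,2-k}(z)s^n .$$ Let $\xi_\kappa f=2iy^\kappa\,\overline{\partial f/\partial\bar z}$ with $\frac{\partial}{\partial \bar z}=\frac12\big(\frac{\partial}{\partial x}+i\frac{\partial}{\partial y}\big)$, and $\Delta_\kappa=y^2\big(\frac{\partial^2}{\partial x^2}+\frac{\partial^2}{\partial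 y^2}\big)-i\kappa y\big(\frac{\partial}{\partial x}+i\frac{\partial}{\partial y}\big)$. Let $V_\kappa^m(0)$ be the space of smooth $f:\mathbb H\to\mathbb C$ that are modular of weight $\kappa$ for $SL(2,\mathbb Z)$, satisfy $\Delta_\kappa^m f=0$, and are $O(y^\alpha)$ as $y\to\infty$, uniformly in $x$, for some $\alpha\in\mathbb R$. Let $E_\kappa^m(0)$ be the space of all $f\in V_\kappa^m(0)$ that are finite linear combinations of the Taylor coefficients (in $s$, at $s=0$) of $\widehat{\widehat E}_\kappa(z,s)$. (1) There are smooth functions $\widetilde G_{n,k}$ and $\widetilde F_{n,2-k}$ ($n\ge0$) on $\mathbb H$ such that for every integer $m\ge1$ the functions $\widetilde G_{0,k},\dots,\widetilde G_{m-1,k}$ form a basis of $E_k^m(0)$ and $\widetilde F_{0,2-k},\dots,\widetilde F_{m-1,2-k}$ form a basis of $E_{2-k}^m(0)$, and such that for all $n\ge0$, with the convention $\widetilde G_{-1,k}=\widetilde F_{-1,2-k}=0$: (a) ("ramp" relations) $\xi_k\widetilde G_{n,k}=(k-1)\widetilde F_{n-1,2-k}$ and $\xi_{2-k}\widetilde F_{n,2-k}=\widetilde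 G_{n,k}$; (b) ("tower" relations) $\Delta_k\widetilde G_{n,k}=(k-1)\widetilde G_{n-1,k}$ and $\Delta_{2-k}\widetilde F_{n,2-k}=(k-1)\widetilde F_{n-1,2-k}$. (2) One choice of such functions is $$\widetilde G_{n,k}=\sum_{\ell=0}^n\frac{(-1)^\ell}{(k-1)^\ell}\binom{n+\ell}{n}G_{n-\ell,k},\qquad \widetilde F_{n,2-k}=(-1)^n\sum_{\ell=0}^n\frac{1}{(k-1)^\ell}\binom{n+\ell}{n}F_{n-\ell,2-k}.$$ -/

import Mathlib

open UpperHalfPlane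
open scoped ModularForm MatrixGroups ContDiff

noncomputable section

namespace PolyharmonicMaass

/-! ### Differential operators on functions on the upper half-plane -/

/-- `∂f/∂x` at `z = x + iy`. -/
def partialX (f : ℍ → ℂ) (z : ℍ) : ℂ := fderiv ℝ (f ∘ ofComplex) (z : ℂ) 1

/-- `∂f/∂y` at `z = x + iy`. -/
def partialY (f : ℍ → ℂ) (z : ℍ) : ℂ := fderiv ℝ (f ∘ ofComplex) (z : ℂ) Complex.I

/-- The Wirtinger derivative `∂f/∂z̄ = (∂f/∂x + i ∂f/∂y) / 2`. -/
def partialZBar (f : ℍ → ℂ) (z : ℍ) : ℂ := (partialX f z + Complex.I * partialY f z) / 2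

/-- The Bruinier–Funke operator: `ξ_k f = 2 i y^k` times the complex conjugate of `∂f/∂z̄`. -/
def xi (k : ℤ) (f : ℍ → ℂ) (z : ℍ) : ℂ :=
  2 * Complex.I * (z.im : ℂ) ^ k * (starRingEnd ℂ) (partialZBar f z)

/-- The weight `k` hyperbolic Laplacian
`Δ_k = y² (∂²/∂x² + ∂²/∂y²) - i k y (∂/∂x + i ∂/∂y)`. -/
def laplacian (k : ℤ) (f : ℍ → ℂ) (z : ℍ) : ℂ :=
  (z.im : ℂ) ^ 2 * (partialX (partialX f) z + partialY (partialY f) z)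
    - Complex.I * (k : ℂ) * (z.im : ℂ) * (partialX f z + Complex.I * partialY f z)

/-! ### The doubly completed non-holomorphic Eisenstein series -/

/-- `E_k(z, s) = (1/2) ∑_{(m,n) ≠ (0,0)} y^s / (|mz+n|^{2s} (mz+n)^k)`; the series converges
absolutely for `Re s > 1 - k/2`. -/
def eisensteinSeries (k : ℤ) (z : ℍ) (s : ℂ) : ℂ :=
  (1 / 2) * ∑' p : {p : ℤ × ℤ // p ≠ 0},
    (z.im : ℂ) ^ s /
      (((‖(p.1.1 : ℂ) * (z : ℂ) + (p.1.2 : ℂ)‖ : ℝ) : ℂ) ^ (2 * s) *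
        ((p.1.1 : ℂ) * (z : ℂ) + (p.1.2 : ℂ)) ^ k)

/-- The doubly completed series
`(s + k/2) (s + k/2 - 1) π^{-(s + k/2)} Γ(s + k/2 + |k|/2) E_k(z, s)`,
meaningful in the half-plane `Re s > 1 - k/2`. -/
def doublyCompletedSeries (k : ℤ) (z : ℍ) (s : ℂ) : ℂ :=
  (s + (k : ℂ) / 2) * (s + (k : ℂ) / 2 - 1) *
    ((Real.pi : ℂ) ^ (-(s + (k : ℂ) / 2)) *
      Complex.Gamma (s + (k : ℂ) / 2 + ((|k| : ℤ) : ℂ) / 2) * eisensteinSeries k z s)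

/-- `f` is the continuation, to an entire function of `s`, of the doubly completed series of
weight `k` at `z`. By the identity theorem there is at most one such `f`. -/
def IsEntireContinuation (k : ℤ) (z : ℍ) (f : ℂ → ℂ) : Prop :=
  Differentiable ℂ f ∧ ∀ s : ℂ, 1 - (k : ℝ) / 2 < s.re → f s = doublyCompletedSeries k z s

open Classical in
/-- The doubly completed Eisenstein series of weight `k` as an entire function of `s` (the
junk value `0` is only taken if there is no entire continuation). -/
def doublyCompleted (k : ℤ) (z : ℍ) : ℂ → ℂ :=
  if h : ∃ f : ℂ → ℂ, IsEntireContinuation k z f then h.choose else 0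

/-- The coefficient of `s^n` in the Taylor expansion at `s = 0` of the doubly completed
Eisenstein series of weight `k`, as a function of `z`. (Called `F_{n,k}` for `k ≤ 0` and
`G_{n,k}` for `k ≥ 2`.) -/
def taylorCoeff (k : ℤ) (n : ℕ) (z : ℍ) : ℂ :=
  iteratedDeriv n (doublyCompleted k z) 0 / (n.factorial : ℂ)

/-! ### Polyharmonic Maass forms and the polyharmonic Eisenstein space -/

/-- Membership in `V_k^m(0)`: smooth, modular of weight `k` for `SL(2, ℤ)`, annihilated by the
`m`-th power of `Δ_k`, and of moderate growth at the cusp, uniformly in `x`. -/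
structure IsPolyharmonicMaassForm (k : ℤ) (m : ℕ) (f : ℍ → ℂ) : Prop where
  smooth : ContDiffOn ℝ ∞ (f ∘ ofComplex) {z : ℂ | 0 < z.im}
  modular : ∀ γ : SL(2, ℤ), f ∣[k] γ = f
  harmonic : (laplacian k)^[m] f = 0
  growth : ∃ α : ℝ, f =O[atImInfty] fun z : ℍ => z.im ^ α

/-- The polyharmonic Eisenstein space `E_k^m(0)`: the forms in `V_k^m(0)` that are linear
combinations of Taylor coefficients of the doubly completed Eisenstein series of weight `k`. -/
def eisensteinSpace (k : ℤ) (m : ℕ) : Set (ℍ → ℂ) :=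
  {f | IsPolyharmonicMaassForm k m f ∧ f ∈ Submodule.span ℂ (Set.range (taylorCoeff k))}

/-- For every `m ≥ 1` the first `m` functions of the sequence are a basis of `E_k^m(0)`. -/
def IsEisensteinBasis (k : ℤ) (f : ℕ → ℍ → ℂ) : Prop :=
  ∀ m : ℕ, 1 ≤ m →
    LinearIndependent ℂ (fun j : Fin m => f j) ∧
      (Submodule.span ℂ (Set.range fun j : Fin m => f j) : Set (ℍ → ℂ)) = eisensteinSpace k m

/-- `f_{n-1}`, with the convention `f_{-1} = 0`. -/
def prev (f : ℕ → ℍ → ℂ) : ℕ → ℍ → ℂ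
  | 0 => 0
  | n + 1 => f n

/-- `G` (weight `k`) and `F` (weight `2 - k`) are bases of the polyharmonic Eisenstein spaces that
satisfy the ramp and tower relations. -/
structure IsModifiedBasis (k : ℤ) (G F : ℕ → ℍ → ℂ) : Prop where
  basis_G : IsEisensteinBasis k G
  basis_F : IsEisensteinBasis (2 - k) F
  ramp_G : ∀ n, xi k (G n) = ((k : ℂ) - 1) • prev F n
  ramp_F : ∀ n, xi (2 - k) (F n) = G n
  tower_G : ∀ n, laplacian k (G n) = ((k : ℂ) - 1) • prev G n
  tower_F : ∀ n, laplacian (2 - k) (F n) = ((k : ℂ) - 1) • prev F n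

/-- `G̃_{n,k} = ∑_{ℓ=0}^n (-1)^ℓ (k-1)^{-ℓ} C(n+ℓ, n) G_{n-ℓ,k}`. -/
def modifiedG (k : ℤ) (n : ℕ) : ℍ → ℂ := fun z =>
  ∑ l ∈ Finset.range (n + 1),
    (-1) ^ l * (1 / ((k : ℂ) - 1) ^ l) * ((n + l).choose n : ℂ) * taylorCoeff k (n - l) z

/-- `F̃_{n,2-k} = (-1)^n ∑_{ℓ=0}^n (k-1)^{-ℓ} C(n+ℓ, n) F_{n-ℓ,2-k}`; the argument is `k`. -/
def modifiedF (k : ℤ) (n : ℕ) : ℍ → ℂ := fun z =>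
  (-1) ^ n * ∑ l ∈ Finset.range (n + 1),
    (1 / ((k : ℂ) - 1) ^ l) * ((n + l).choose n : ℂ) * taylorCoeff (2 - k) (n - l) z

end PolyharmonicMaass

end

/-!
Theta series with a harmonic polynomial factor have the completed Eisenstein series as Mellin
transform. Splitting the integral at `t = 1` and folding `(0, 1)` onto `(1, ∞)` by Poisson summation
gives the entire continuation, and makes every Taylor coefficient at `s = 0` a combination of
integrals over `(1, ∞)` of a theta series against `t ^ s (log t) ^ n`.

Differentiating under the integral, `ξ_{-a}` maps the alternating Taylor coefficients of weight
`-a` to those of weight `a + 2`. In the opposite direction an integration by parts, whose boundary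
term at `t = 1` is evaluated by the functional equation of the theta series, gives the recursion
`ξ_{a+2} G_n = (a + 1) F_{n-1} + F_{n-2}`. The coefficients `(-1)^ℓ κ^{-ℓ} C(n+ℓ, n)` with
`κ = a + 1 = k - 1` are the ones that, by Pascal's rule, remove the last term; this yields the ramp
relations, and `Δ_k = ξ_{2-k} ξ_k` the tower relations. On a sequence `X` with
`Δ X_n = κ X_{n-1}` and `X_0 ≠ 0`, the kernel of `Δ^m` in the span is spanned by the first `m`
terms.
-/

noncomputable section

namespace PolyharmonicMaass

open Complex Filter Topology MeasureTheory

/-- `f` is real differentiable at `z` with `df = A dz + B dz̄`. -/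
def HasWirtingerDerivAt (f : ℂ → ℂ) (A B z : ℂ) : Prop :=
  HasFDerivAt f (A • (1 : ℂ →L[ℝ] ℂ) + B • (conjCLE : ℂ →L[ℝ] ℂ)) z

namespace HasWirtingerDerivAt

variable {f g : ℂ → ℂ} {A B A' B' z : ℂ}

lemma congr_deriv (h : HasWirtingerDerivAt f A B z) (hA : A = A') (hB : B = B') :
    HasWirtingerDerivAt f A' B' z := by
  subst hA hB
  exact h

lemma congr_of_eventuallyEq (h : HasWirtingerDerivAt f A B z) (hgf : g =ᶠ[𝓝 z] f) :
    HasWirtingerDerivAt g A B z :=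
  HasFDerivAt.congr_of_eventuallyEq h hgf

lemma of_differentiableAt (h : DifferentiableAt ℝ f z) :
    HasWirtingerDerivAt f ((fderiv ℝ f z 1 - Complex.I * fderiv ℝ f z Complex.I) / 2)
      ((fderiv ℝ f z 1 + Complex.I * fderiv ℝ f z Complex.I) / 2) z := by
  refine h.hasFDerivAt.congr_fderiv (ContinuousLinearMap.coe_injective (basisOneI.ext fun j => ?_))
  fin_cases j
  · simp
    ring
  · simp
    linear_combination fderiv ℝ f z Complex.I * I_sq

lemma fderiv_one_add_I_mul (h : HasWirtingerDerivAt f A B z) :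
    (fderiv ℝ f z 1 + Complex.I * fderiv ℝ f z Complex.I) / 2 = B := by
  rw [HasFDerivAt.fderiv h]
  simp
  linear_combination (A - B) / 2 * I_sq

lemma unique_conj (hf : HasWirtingerDerivAt f A B z) (hf' : HasWirtingerDerivAt f A' B' z) :
    B = B' :=
  hf.fderiv_one_add_I_mul.symm.trans hf'.fderiv_one_add_I_mul

lemma const (c : ℂ) : HasWirtingerDerivAt (fun _ => c) 0 0 z :=
  (hasFDerivAt_const c z).congr_fderiv (by module)

lemma id : HasWirtingerDerivAt (fun w => w) 1 0 z :=
  (hasFDerivAt_id z).congr_fderiv (by ext; simp)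

lemma conj (hf : HasWirtingerDerivAt f A B z) :
    HasWirtingerDerivAt (fun w => starRingEnd ℂ (f w)) (starRingEnd ℂ B) (starRingEnd ℂ A) z :=
  ((conjCLE : ℂ →L[ℝ] ℂ).hasFDerivAt.comp z hf).congr_fderiv (by ext; simp; ring)

lemma add (hf : HasWirtingerDerivAt f A B z) (hg : HasWirtingerDerivAt g A' B' z) :
    HasWirtingerDerivAt (fun w => f w + g w) (A + A') (B + B') z :=
  (HasFDerivAt.add hf hg).congr_fderiv (by module)

lemma mul (hf : HasWirtingerDerivAt f A B z) (hg : HasWirtingerDerivAt g A' B' z) :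
    HasWirtingerDerivAt (fun w => f w * g w) (A * g z + f z * A') (B * g z + f z * B') z :=
  (HasFDerivAt.mul hf hg).congr_fderiv (by module)

lemma const_mul (c : ℂ) (hf : HasWirtingerDerivAt f A B z) :
    HasWirtingerDerivAt (fun w => c * f w) (c * A) (c * B) z :=
  (HasFDerivAt.const_mul hf c).congr_fderiv (by module)

lemma comp_of_hasDerivAt {φ : ℂ → ℂ} {φ' : ℂ} (hφ : HasDerivAt φ φ' (f z))
    (hf : HasWirtingerDerivAt f A B z) :
    HasWirtingerDerivAt (fun w => φ (f w)) (φ' * A) (φ' * B) z :=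
  ((hφ.hasFDerivAt.restrictScalars ℝ).comp z hf).congr_fderiv (by ext; simp; ring)

lemma im : HasWirtingerDerivAt (fun w => (w.im : ℂ)) (-Complex.I / 2) (Complex.I / 2) z := by
  refine (((id.add (id.conj.const_mul (-1))).const_mul (-Complex.I / 2)).congr_of_eventuallyEq
    (.of_forall fun w => ?_)).congr_deriv (by simp) (by simp; ring)
  dsimp only
  rw [neg_one_mul, ← sub_eq_add_neg, sub_conj]
  push_cast
  linear_combination (w.im : ℂ) * I_sq

end HasWirtingerDerivAt

lemma comp_ofComplex_eventuallyEq {f : ℍ → ℂ} {φ : ℂ → ℂ} (h : ∀ z : ℍ, f z = φ z) (z : ℍ) :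
    f ∘ ofComplex =ᶠ[𝓝 (z : ℂ)] φ := by
  filter_upwards [isOpen_upperHalfPlaneSet.mem_nhds z.2] with w hw
  simp [h, ofComplex_apply_of_im_pos hw]

lemma HasWirtingerDerivAt.partialZBar_eq {f : ℍ → ℂ} {φ : ℂ → ℂ} {A B : ℂ} {z : ℍ}
    (hφ : HasWirtingerDerivAt φ A B z) (h : ∀ z : ℍ, f z = φ z) :
    partialZBar f z = B :=
  (hφ.congr_of_eventuallyEq (comp_ofComplex_eventuallyEq h z)).fderiv_one_add_I_mul

/-- The complex vector space of smooth functions on the upper half-plane. -/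
def smoothFunctions : Submodule ℂ (ℍ → ℂ) where
  carrier := {f | ContDiffOn ℝ ∞ (f ∘ ofComplex) upperHalfPlaneSet}
  add_mem' hf hg := ContDiffOn.add hf hg
  zero_mem' := contDiffOn_const
  smul_mem' _ _ hf := contDiffOn_const.smul hf

lemma mem_smoothFunctions_of_contDiffOn {φ : ℂ → ℂ} (hφ : ContDiffOn ℝ ∞ φ upperHalfPlaneSet) :
    (fun z : ℍ => φ z) ∈ smoothFunctions :=
  hφ.congr fun w hw => by simp [ofComplex_apply_of_im_pos hw]

/-- The derivative of `f` in the constant direction `v`. Treats `partialX` (`v = 1`) and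
`partialY` (`v = i`), to which it is definitionally equal, at the same time. -/
def directionalDeriv (v : ℂ) (f : ℍ → ℂ) (z : ℍ) : ℂ := fderiv ℝ (f ∘ ofComplex) (z : ℂ) v

section smoothFunctions

variable {f g : ℍ → ℂ}

lemma contDiffAt_of_mem_smoothFunctions (hf : f ∈ smoothFunctions) (z : ℍ) :
    ContDiffAt ℝ ∞ (f ∘ ofComplex) z :=
  ContDiffOn.contDiffAt hf (isOpen_upperHalfPlaneSet.mem_nhds z.2)

lemma differentiableAt_of_mem_smoothFunctions (hf : f ∈ smoothFunctions) (z : ℍ) :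
    DifferentiableAt ℝ (f ∘ ofComplex) z :=
  (contDiffAt_of_mem_smoothFunctions hf z).differentiableAt (by simp)

lemma directionalDeriv_add (hf : f ∈ smoothFunctions) (hg : g ∈ smoothFunctions) (v : ℂ) :
    directionalDeriv v (f + g) = directionalDeriv v f + directionalDeriv v g := by
  ext z
  change fderiv ℝ (f ∘ ofComplex + g ∘ ofComplex) z v = _
  rw [fderiv_add (differentiableAt_of_mem_smoothFunctions hf z)
    (differentiableAt_of_mem_smoothFunctions hg z)]
  rfl

lemma directionalDeriv_smul (hf : f ∈ smoothFunctions) (c v : ℂ) :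
    directionalDeriv v (c • f) = c • directionalDeriv v f := by
  ext z
  change fderiv ℝ (c • (f ∘ ofComplex)) z v = _
  rw [fderiv_const_smul (differentiableAt_of_mem_smoothFunctions hf z)]
  rfl

lemma directionalDeriv_mem_smoothFunctions (hf : f ∈ smoothFunctions) (v : ℂ) :
    directionalDeriv v f ∈ smoothFunctions :=
  mem_smoothFunctions_of_contDiffOn (φ := fun w => fderiv ℝ (f ∘ ofComplex) w v)
    ((ContDiffOn.fderiv_of_isOpen hf isOpen_upperHalfPlaneSet (by simp)).clm_apply
      contDiffOn_const)

lemma directionalDeriv_directionalDeriv (hf : f ∈ smoothFunctions) (v w : ℂ) (z : ℍ) :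
    directionalDeriv v (directionalDeriv w f) z =
      fderiv ℝ (fderiv ℝ (f ∘ ofComplex)) (z : ℂ) v w := by
  have hd : DifferentiableAt ℝ (fderiv ℝ (f ∘ ofComplex)) (z : ℂ) :=
    ((contDiffAt_of_mem_smoothFunctions hf z).fderiv_right (m := 1) (by norm_cast)).differentiableAt
      (by simp)
  have heq : directionalDeriv w f ∘ ofComplex =ᶠ[𝓝 (z : ℂ)]
      fun u => fderiv ℝ (f ∘ ofComplex) u w :=
    comp_ofComplex_eventuallyEq (f := directionalDeriv w f) (fun _ => rfl) z
  rw [directionalDeriv, heq.fderiv_eq, fderiv_clm_apply hd (by fun_prop)]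
  simp

lemma directionalDeriv_comm (hf : f ∈ smoothFunctions) (v w : ℂ) :
    directionalDeriv v (directionalDeriv w f) = directionalDeriv w (directionalDeriv v f) := by
  ext z
  rw [directionalDeriv_directionalDeriv hf, directionalDeriv_directionalDeriv hf]
  exact (contDiffAt_of_mem_smoothFunctions hf z).isSymmSndFDerivAt (by simp; norm_cast) v w

lemma partialZBar_eq_smul_add_smul (f : ℍ → ℂ) :
    partialZBar f =
      (1 / 2 : ℂ) • directionalDeriv 1 f + (Complex.I / 2) • directionalDeriv Complex.I f := by
  ext z
  simp only [partialZBar, partialX, partialY, directionalDeriv, Pi.add_apply, Pi.smul_apply,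
    smul_eq_mul]
  ring

lemma partialZBar_mem_smoothFunctions (hf : f ∈ smoothFunctions) :
    partialZBar f ∈ smoothFunctions := by
  rw [partialZBar_eq_smul_add_smul]
  exact add_mem (smoothFunctions.smul_mem _ (directionalDeriv_mem_smoothFunctions hf _))
    (smoothFunctions.smul_mem _ (directionalDeriv_mem_smoothFunctions hf _))

lemma partialZBar_add (hf : f ∈ smoothFunctions) (hg : g ∈ smoothFunctions) :
    partialZBar (f + g) = partialZBar f + partialZBar g := by
  simp only [partialZBar_eq_smul_add_smul, directionalDeriv_add hf hg, smul_add]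
  abel

lemma partialZBar_smul (hf : f ∈ smoothFunctions) (c : ℂ) :
    partialZBar (c • f) = c • partialZBar f := by
  simp only [partialZBar_eq_smul_add_smul, directionalDeriv_smul hf]
  module

lemma directionalDeriv_partialZBar (hf : f ∈ smoothFunctions) (v : ℂ) :
    directionalDeriv v (partialZBar f) = (1 / 2 : ℂ) • directionalDeriv v (directionalDeriv 1 f) +
      (Complex.I / 2) • directionalDeriv v (directionalDeriv Complex.I f) := by
  have h (w : ℂ) := directionalDeriv_mem_smoothFunctions hf w
  rw [partialZBar_eq_smul_add_smul,
    directionalDeriv_add (smoothFunctions.smul_mem _ (h 1)) (smoothFunctions.smul_mem _ (h _)),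
    directionalDeriv_smul (h 1), directionalDeriv_smul (h _)]

lemma partialX_partialX_add_partialY_partialY (hf : f ∈ smoothFunctions) :
    partialX (partialX f) + partialY (partialY f) =
      (2 : ℂ) • (directionalDeriv 1 (partialZBar f) -
        Complex.I • directionalDeriv Complex.I (partialZBar f)) := by
  rw [directionalDeriv_partialZBar hf, directionalDeriv_partialZBar hf,
    directionalDeriv_comm hf Complex.I 1]
  ext z
  change directionalDeriv 1 (directionalDeriv 1 f) z +
    directionalDeriv Complex.I (directionalDeriv Complex.I f) z = _
  simp only [Pi.smul_apply, Pi.sub_apply, Pi.add_apply, smul_eq_mul]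
  linear_combination directionalDeriv Complex.I (directionalDeriv Complex.I f) z * I_sq

variable (k : ℤ)

lemma xi_eq (f : ℍ → ℂ) (z : ℍ) :
    xi k f z = 2 * Complex.I * (((z : ℂ).im : ℂ) ^ k * starRingEnd ℂ (partialZBar f z)) := by
  rw [xi, mul_assoc, coe_im]

lemma hasWirtingerDerivAt_im_zpow (z : ℍ) :
    HasWirtingerDerivAt (fun w : ℂ => (w.im : ℂ) ^ k)
      (k * (z.im : ℂ) ^ (k - 1) * (-Complex.I / 2)) (k * (z.im : ℂ) ^ (k - 1) * (Complex.I / 2))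
      z :=
  HasWirtingerDerivAt.im.comp_of_hasDerivAt
    (hasDerivAt_zpow k (z.im : ℂ) (Or.inl (ofReal_ne_zero.2 z.im_ne_zero)))

lemma xi_mem_smoothFunctions (hf : f ∈ smoothFunctions) : xi k f ∈ smoothFunctions := by
  have him : ContDiffOn ℝ ∞ (fun w : ℂ => (w.im : ℂ) ^ k) upperHalfPlaneSet := by
    have h : ContDiffOn ℝ ∞ (fun w : ℂ => (w.im : ℂ)) upperHalfPlaneSet :=
      (ofRealCLM.contDiff.comp imCLM.contDiff).contDiffOn
    obtain ⟨n, rfl | rfl⟩ := k.eq_nat_or_neg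
    · simpa only [zpow_natCast] using h.pow n
    · simp only [zpow_neg, zpow_natCast]
      exact (h.pow n).inv fun w hw => pow_ne_zero n (ofReal_ne_zero.2 hw.ne')
  have hconj : ContDiffOn ℝ ∞ (fun w => starRingEnd ℂ ((partialZBar f ∘ ofComplex) w))
      upperHalfPlaneSet :=
    (conjCLE : ℂ →L[ℝ] ℂ).contDiff.comp_contDiffOn (partialZBar_mem_smoothFunctions hf)
  convert mem_smoothFunctions_of_contDiffOn
    (contDiffOn_const (c := 2 * Complex.I).mul (him.mul hconj)) using 1
  ext z
  simp [xi_eq]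

lemma xi_add (hf : f ∈ smoothFunctions) (hg : g ∈ smoothFunctions) :
    xi k (f + g) = xi k f + xi k g := by
  ext z
  simp only [xi, partialZBar_add hf hg, Pi.add_apply, map_add, mul_add]

lemma xi_smul (hf : f ∈ smoothFunctions) (c : ℂ) :
    xi k (c • f) = starRingEnd ℂ c • xi k f := by
  ext z
  simp only [xi, partialZBar_smul hf, Pi.smul_apply, smul_eq_mul, map_mul]
  ring

lemma xi_zero : xi k 0 = 0 := by
  simpa using xi_smul k smoothFunctions.zero_mem 0

lemma xi_sum {ι : Type*} (s : Finset ι) (c : ι → ℂ) {X : ι → ℍ → ℂ}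
    (hX : ∀ i, X i ∈ smoothFunctions) :
    xi k (∑ i ∈ s, c i • X i) = ∑ i ∈ s, starRingEnd ℂ (c i) • xi k (X i) := by
  classical
  induction s using Finset.induction_on with
  | empty => simpa using xi_zero k
  | insert i s hi ih =>
    rw [Finset.sum_insert hi, Finset.sum_insert hi,
      xi_add k (smoothFunctions.smul_mem _ (hX i))
        (sum_mem fun j _ => smoothFunctions.smul_mem _ (hX j)), xi_smul k (hX i), ih]

lemma partialZBar_xi (hf : f ∈ smoothFunctions) (z : ℍ) :
    partialZBar (xi k f) z =
      2 * Complex.I * (k * (z.im : ℂ) ^ (k - 1) * (Complex.I / 2) * starRingEnd ℂ (partialZBar f z)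
        + (z.im : ℂ) ^ k * starRingEnd ℂ ((directionalDeriv 1 (partialZBar f) z -
          Complex.I * directionalDeriv Complex.I (partialZBar f) z) / 2)) := by
  have hbar := (HasWirtingerDerivAt.of_differentiableAt
    (differentiableAt_of_mem_smoothFunctions (partialZBar_mem_smoothFunctions hf) z)).conj
  have := (((hasWirtingerDerivAt_im_zpow k z).mul hbar).const_mul (2 * Complex.I)).partialZBar_eq
    (f := xi k f) fun w => by simp [xi_eq]
  simpa [directionalDeriv] using this

lemma laplacian_eq_xi_xi (hf : f ∈ smoothFunctions) : laplacian k f = xi (2 - k) (xi k f) := by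
  ext z
  have hy : (z.im : ℂ) ≠ 0 := ofReal_ne_zero.2 z.im_ne_zero
  have hlap := congrFun (partialX_partialX_add_partialY_partialY hf) z
  simp only [Pi.add_apply, Pi.sub_apply, Pi.smul_apply, smul_eq_mul] at hlap
  have hzbar : partialX f z + Complex.I * partialY f z = 2 * partialZBar f z := by
    rw [partialZBar]
    ring
  rw [laplacian, hlap, hzbar, xi, partialZBar_xi k hf]
  simp only [map_mul, map_add, map_zpow₀, map_div₀, conj_I, conj_ofReal, conj_conj, map_intCast,
    map_ofNat]
  rw [zpow_sub_one₀ hy, zpow_sub₀ hy]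
  field_simp
  rw [I_sq]
  ring

lemma laplacian_sum {ι : Type*} (s : Finset ι) (c : ι → ℂ) {X : ι → ℍ → ℂ}
    (hX : ∀ i, X i ∈ smoothFunctions) :
    laplacian k (∑ i ∈ s, c i • X i) = ∑ i ∈ s, c i • laplacian k (X i) := by
  rw [laplacian_eq_xi_xi k (sum_mem fun j _ => smoothFunctions.smul_mem _ (hX j)), xi_sum k s c hX,
    xi_sum _ s _ fun i => xi_mem_smoothFunctions k (hX i)]
  simp only [conj_conj, laplacian_eq_xi_xi k (hX _)]

end smoothFunctions

/-- The index set of the Eisenstein lattice sums. -/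
abbrev NonzeroPair : Type := {p : ℤ × ℤ // p ≠ 0}

/-- The linear form `m z + n` attached to `p = (m, n)`. -/
def linForm (p : ℤ × ℤ) (z : ℂ) : ℂ := p.1 * z + p.2

/-- With `w = m z + n`, the summand `m ^ i w ^ a w̄ ^ b exp (-π t |w|² / y)`. -/
def thetaTerm (i a b : ℕ) (p : ℤ × ℤ) (z : ℂ) (t : ℝ) : ℂ :=
  (p.1 : ℂ) ^ i * linForm p z ^ a * starRingEnd ℂ (linForm p z) ^ b *
    cexp (-(Real.pi * t) * (linForm p z * starRingEnd ℂ (linForm p z) * (z.im : ℂ)⁻¹))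

lemma norm_thetaTerm (i a b : ℕ) (p : ℤ × ℤ) (z : ℂ) (t : ℝ) :
    ‖thetaTerm i a b p z t‖ = |(p.1 : ℝ)| ^ i * ‖linForm p z‖ ^ (a + b) *
      Real.exp (-(Real.pi * t * ‖linForm p z‖ ^ 2 / z.im)) := by
  have : (-(Real.pi * t) * (linForm p z * starRingEnd ℂ (linForm p z) * (z.im : ℂ)⁻¹) : ℂ) =
      ((-(Real.pi * t * ‖linForm p z‖ ^ 2 / z.im) : ℝ) : ℂ) := by
    rw [mul_conj, normSq_eq_norm_sq]; push_cast; ring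
  rw [thetaTerm, this, norm_mul, norm_exp_ofReal]
  simp [pow_add]
  ring

lemma norm_prod_int_eq (p : ℤ × ℤ) : ‖![p.1, p.2]‖ = ‖p‖ := by
  rw [EisensteinSeries.norm_eq_max_natAbs, Prod.norm_def]
  simp [Int.norm_eq_abs, Nat.cast_natAbs]

lemma one_le_norm_of_ne_zero {p : ℤ × ℤ} (hp : p ≠ 0) : 1 ≤ ‖p‖ := by
  rw [Prod.norm_def]
  have : p.1 ≠ 0 ∨ p.2 ≠ 0 := by
    by_contra! h
    exact hp (Prod.ext h.1 h.2)
  rcases this with h | h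
  · exact le_max_of_le_left (by rw [Int.norm_eq_abs]; exact_mod_cast Int.one_le_abs h)
  · exact le_max_of_le_right (by rw [Int.norm_eq_abs]; exact_mod_cast Int.one_le_abs h)

lemma exists_mul_norm_le_norm_linForm (A : ℝ) {B : ℝ} (hB : 0 < B) :
    ∃ r : ℝ, 0 < r ∧ ∀ z : ℂ, |z.re| ≤ A → B ≤ z.im → ∀ p : ℤ × ℤ, p ≠ 0 →
      r * ‖p‖ ≤ ‖linForm p z‖ := by
  refine ⟨EisensteinSeries.r ⟨⟨A, B⟩, hB⟩, EisensteinSeries.r_pos _, fun z hA hz p hp => ?_⟩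
  have hp' : ![p.1, p.2] ≠ 0 := fun h =>
    hp (Prod.ext (by simpa using congr_fun h 0) (by simpa using congr_fun h 1))
  have h1 := EisensteinSeries.r_mul_max_le ⟨z, hB.trans_le hz⟩ hp'
  have h2 := EisensteinSeries.r_lower_bound_on_verticalStrip ⟨z, hB.trans_le hz⟩ hB
    (A := A) ⟨hA, hz⟩
  rw [norm_prod_int_eq] at h1
  refine (mul_le_mul_of_nonneg_right h2 (norm_nonneg _)).trans (h1.trans (le_of_eq ?_))
  simp [linForm]

lemma exp_neg_le_factorial_div_pow {u : ℝ} (hu : 0 < u) (N : ℕ) :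
    Real.exp (-u) ≤ N.factorial / u ^ N := by
  rw [Real.exp_neg, ← inv_div]
  exact inv_anti₀ (by positivity) (Real.pow_div_factorial_le_exp u hu.le N)

lemma exists_norm_thetaTerm_le (i a b N : ℕ) (hN : i + a + b + 3 ≤ 2 * N) (A : ℝ) {B : ℝ}
    (hB : 0 < B) :
    ∃ C : ℝ, 0 ≤ C ∧ ∀ z : ℂ, |z.re| ≤ A → B ≤ z.im → ∀ p : ℤ × ℤ, p ≠ 0 → ∀ t : ℝ, 0 < t →
      ‖thetaTerm i a b p z t‖ ≤ C * (z.im / t) ^ N * (‖p‖ ^ 3)⁻¹ := by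
  obtain ⟨r, hr, hr'⟩ := exists_mul_norm_le_norm_linForm A hB
  obtain ⟨d, hd⟩ : ∃ d, 2 * N = a + b + d := ⟨2 * N - (a + b), by omega⟩
  refine ⟨N.factorial / Real.pi ^ N / r ^ d, by positivity, fun z hA hz p hp t ht => ?_⟩
  have hy : 0 < z.im := hB.trans_le hz
  have hp1 := one_le_norm_of_ne_zero hp
  have hw := hr' z hA hz p hp
  have hm : |(p.1 : ℝ)| ≤ ‖p‖ := by
    rw [← Int.norm_eq_abs]
    exact norm_fst_le p
  rw [norm_thetaTerm]
  set W := ‖linForm p z‖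
  have hWpos : 0 < W := lt_of_lt_of_le (by positivity) hw
  have hW : (W ^ 2) ^ N = W ^ (a + b) * W ^ d := by rw [← pow_mul, hd, pow_add]
  calc |(p.1 : ℝ)| ^ i * W ^ (a + b) * Real.exp (-(Real.pi * t * W ^ 2 / z.im))
      ≤ ‖p‖ ^ i * W ^ (a + b) * (N.factorial / (Real.pi * t * W ^ 2 / z.im) ^ N) := by
        gcongr
        exact exp_neg_le_factorial_div_pow (by positivity) N
    _ = ‖p‖ ^ i * (N.factorial / Real.pi ^ N) * (z.im / t) ^ N / W ^ d := by
        rw [div_pow, mul_pow, mul_pow, hW, div_pow]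
        field_simp
    _ ≤ ‖p‖ ^ i * (N.factorial / Real.pi ^ N) * (z.im / t) ^ N / (r * ‖p‖) ^ d := by gcongr
    _ = (N.factorial / Real.pi ^ N / r ^ d) * (z.im / t) ^ N * (‖p‖ ^ i / ‖p‖ ^ d) := by
        rw [mul_pow]
        field_simp
    _ ≤ (N.factorial / Real.pi ^ N / r ^ d) * (z.im / t) ^ N * (‖p‖ ^ 3)⁻¹ := by
        gcongr
        rw [← one_div, div_le_div_iff₀ (by positivity) (by positivity), ← pow_add, one_mul]
        exact pow_le_pow_right₀ hp1 (by omega)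

lemma summable_norm_prod_int_rpow {σ : ℝ} (hσ : 2 < σ) :
    Summable fun p : NonzeroPair => ‖p.1‖ ^ (-σ) := by
  have h := EisensteinSeries.summable_one_div_norm_rpow hσ
  rw [← (finTwoArrowEquiv ℤ).symm.summable_iff] at h
  exact (h.subtype {p : ℤ × ℤ | p ≠ 0}).congr fun p => by simp [← norm_prod_int_eq]

lemma summable_norm_prod_int_cube_inv : Summable fun p : NonzeroPair => (‖p.1‖ ^ 3)⁻¹ := by
  refine (summable_norm_prod_int_rpow (σ := 3) (by norm_num)).congr fun p => ?_
  rw [Real.rpow_neg (norm_nonneg _)]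
  norm_cast

lemma conj_thetaTerm (i a b : ℕ) (p : ℤ × ℤ) (z : ℂ) (t : ℝ) :
    starRingEnd ℂ (thetaTerm i a b p z t) = thetaTerm i b a p z t := by
  simp only [thetaTerm, map_mul, map_pow, ← Complex.exp_conj, map_neg, map_inv₀, conj_ofReal,
    conj_conj, map_intCast]
  ring_nf

lemma hasWirtingerDerivAt_linForm (p : ℤ × ℤ) (z : ℂ) :
    HasWirtingerDerivAt (linForm p) p.1 0 z :=
  ((HasWirtingerDerivAt.id.const_mul (p.1 : ℂ)).add (.const (p.2 : ℂ))).congr_deriv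
    (by ring) (by ring)

lemma linForm_sub_conj (p : ℤ × ℤ) (z : ℂ) :
    linForm p z - starRingEnd ℂ (linForm p z) = 2 * Complex.I * p.1 * z.im := by
  rw [Complex.sub_conj]
  simp only [linForm, add_im, mul_im, intCast_re, intCast_im, zero_mul, add_zero]
  push_cast
  ring

lemma hasWirtingerDerivAt_linForm_mul_conj_div_im (p : ℤ × ℤ) {z : ℂ} (hz : 0 < z.im) :
    HasWirtingerDerivAt (fun w => linForm p w * starRingEnd ℂ (linForm p w) * (w.im : ℂ)⁻¹)
      (Complex.I / 2 * ((z.im : ℂ)⁻¹) ^ 2 * starRingEnd ℂ (linForm p z) ^ 2)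
      (-(Complex.I / 2) * ((z.im : ℂ)⁻¹) ^ 2 * linForm p z ^ 2) z := by
  have hy : (z.im : ℂ) ≠ 0 := ofReal_ne_zero.2 hz.ne'
  have hw := hasWirtingerDerivAt_linForm p z
  have hsub := linForm_sub_conj p z
  refine ((hw.mul hw.conj).mul (HasWirtingerDerivAt.im.comp_of_hasDerivAt
    (hasDerivAt_inv hy))).congr_deriv ?_ ?_
  · rw [map_zero]
    field_simp
    linear_combination (Complex.I * starRingEnd ℂ (linForm p z)) * hsub +
      2 * (p.1 : ℂ) * z.im * starRingEnd ℂ (linForm p z) * I_sq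
  · rw [map_intCast]
    field_simp
    linear_combination (Complex.I * linForm p z) * hsub +
      2 * (p.1 : ℂ) * z.im * linForm p z * I_sq

lemma hasWirtingerDerivAt_thetaTerm (i a b : ℕ) (p : ℤ × ℤ) {z : ℂ} (hz : 0 < z.im) (t : ℝ) :
    HasWirtingerDerivAt (fun w => thetaTerm i a b p w t)
      (a * thetaTerm (i + 1) (a - 1) b p z t -
        Complex.I / 2 * Real.pi * ((z.im : ℂ)⁻¹) ^ 2 * (t * thetaTerm i a (b + 2) p z t))
      (b * thetaTerm (i + 1) a (b - 1) p z t +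
        Complex.I / 2 * Real.pi * ((z.im : ℂ)⁻¹) ^ 2 * (t * thetaTerm i (a + 2) b p z t)) z := by
  have hw := hasWirtingerDerivAt_linForm p z
  have hpow := ((hw.comp_of_hasDerivAt (hasDerivAt_pow a _)).const_mul ((p.1 : ℂ) ^ i)).mul
    (hw.conj.comp_of_hasDerivAt (hasDerivAt_pow b _))
  have hexp := ((hasWirtingerDerivAt_linForm_mul_conj_div_im p hz).const_mul
    (-(Real.pi * t))).comp_of_hasDerivAt (Complex.hasDerivAt_exp _)
  refine (hpow.mul hexp).congr_deriv ?_ ?_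
  · simp only [thetaTerm, map_zero]
    ring
  · simp only [thetaTerm, map_intCast]
    ring

section DominatedNear

variable {α : Type*} {mα : MeasurableSpace α} {μ : Measure α} {F G : ℂ → α → ℂ} {z : ℂ}

/-- For `w` near `z` the functions `F w` are dominated by a common `μ`-integrable function; this
is the hypothesis for differentiation under the integral sign at `z`. -/
def DominatedNear (μ : Measure α) (F : ℂ → α → ℂ) (z : ℂ) : Prop :=
  ∃ S ∈ 𝓝 z, ∃ g : α → ℝ, Integrable g μ ∧ ∀ᵐ x ∂μ, ∀ w ∈ S, ‖F w x‖ ≤ g x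

namespace DominatedNear

lemma integrable (hF : DominatedNear μ F z) (hm : AEStronglyMeasurable (F z) μ) :
    Integrable (F z) μ := by
  obtain ⟨S, hS, g, hg, hFg⟩ := hF
  exact hg.mono' hm (hFg.mono fun x hx => hx z (mem_of_mem_nhds hS))

lemma add (hF : DominatedNear μ F z) (hG : DominatedNear μ G z) :
    DominatedNear μ (fun w x => F w x + G w x) z := by
  obtain ⟨S, hS, f, hf, hFf⟩ := hF
  obtain ⟨T, hT, g, hg, hGg⟩ := hG
  refine ⟨S ∩ T, inter_mem hS hT, fun x => f x + g x, hf.add hg, ?_⟩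
  filter_upwards [hFf, hGg] with x hx hx' w hw
  exact norm_add_le_of_le (hx w hw.1) (hx' w hw.2)

lemma mul_left {c : ℂ → ℂ} (hc : ContinuousAt c z) (hF : DominatedNear μ F z) :
    DominatedNear μ (fun w x => c w * F w x) z := by
  obtain ⟨S, hS, f, hf, hFf⟩ := hF
  have hT : {w | ‖c w‖ < ‖c z‖ + 1} ∈ 𝓝 z := hc.norm.eventually_lt_const (lt_add_one _)
  refine ⟨S ∩ {w | ‖c w‖ < ‖c z‖ + 1}, inter_mem hS hT, fun x => (‖c z‖ + 1) * f x,
    hf.const_mul _, ?_⟩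
  filter_upwards [hFf] with x hx w hw
  exact norm_mul_le_of_le hw.2.le (hx w hw.1)

end DominatedNear

theorem HasWirtingerDerivAt.integral {FA FB : ℂ → α → ℂ} {S : Set ℂ} (hS : S ∈ 𝓝 z)
    (hFm : ∀ w, AEStronglyMeasurable (F w) μ) (hF : Integrable (F z) μ)
    (hA : DominatedNear μ FA z) (hAm : AEStronglyMeasurable (FA z) μ)
    (hB : DominatedNear μ FB z) (hBm : AEStronglyMeasurable (FB z) μ)
    (hderiv : ∀ᵐ x ∂μ, ∀ w ∈ S, HasWirtingerDerivAt (fun w => F w x) (FA w x) (FB w x) w) :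
    HasWirtingerDerivAt (fun w => ∫ x, F w x ∂μ) (∫ x, FA z x ∂μ) (∫ x, FB z x ∂μ) z := by
  have hAi := hA.integrable hAm
  have hBi := hB.integrable hBm
  obtain ⟨SA, hSA, gA, hgA, hFA⟩ := hA
  obtain ⟨SB, hSB, gB, hgB, hFB⟩ := hB
  have key := hasFDerivAt_integral_of_dominated_of_fderiv_le (𝕜 := ℝ) (μ := μ) (F := F)
    (F' := fun w x => FA w x • (1 : ℂ →L[ℝ] ℂ) + FB w x • (conjCLE : ℂ →L[ℝ] ℂ))
    (bound := fun x => gA x * ‖(1 : ℂ →L[ℝ] ℂ)‖ + gB x * ‖(conjCLE : ℂ →L[ℝ] ℂ)‖)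
    (inter_mem hS (inter_mem hSA hSB)) (.of_forall hFm) hF
    ((hAm.smul_const _).add (hBm.smul_const _)) ?_ ((hgA.mul_const _).add (hgB.mul_const _))
    (hderiv.mono fun x hx w hw => hx w hw.1)
  · rwa [integral_add (hAi.smul_const _) (hBi.smul_const _), integral_smul_const,
      integral_smul_const] at key
  · filter_upwards [hFA, hFB] with x hxA hxB w ⟨_, hwA, hwB⟩
    refine norm_add_le_of_le ?_ ?_
    · rw [norm_smul]
      gcongr
      exact hxA w hwA
    · rw [norm_smul]
      gcongr
      exact hxB w hwB

end DominatedNear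

/-- `h` grows at most polynomially, in the sense that `h t / t ^ N` is `ν`-integrable for all
large `N`. -/
def Admissible (ν : Measure ℝ) (h : ℝ → ℂ) : Prop :=
  AEStronglyMeasurable h ν ∧
    ∃ N₀ : ℕ, ∀ N ≥ N₀, Integrable (fun t => ‖h t‖ * (t ^ N)⁻¹) ν

lemma Admissible.mul_id {ν : Measure ℝ} (hν : ∀ᵐ t ∂ν, 0 < t) {h : ℝ → ℂ} (hh : Admissible ν h) :
    Admissible ν fun t => t * h t := by
  obtain ⟨hm, N₀, hN⟩ := hh
  refine ⟨continuous_ofReal.aestronglyMeasurable.mul hm, N₀ + 1, fun N hN' => ?_⟩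
  obtain ⟨M, rfl⟩ : ∃ M, N = M + 1 := ⟨N - 1, by omega⟩
  refine (hN M (by omega)).congr ?_
  filter_upwards [hν] with t ht
  rw [norm_mul, norm_real, Real.norm_of_nonneg ht.le]
  field_simp
  ring

/-- The function `h t * thetaTerm i a b p z t` of `(t, p)`, whose integral is `thetaIntegral`. -/
def thetaIntegrand (i a b : ℕ) (h : ℝ → ℂ) (z : ℂ) (x : ℝ × NonzeroPair) : ℂ :=
  h x.1 * thetaTerm i a b x.2 z x.1

/-- The integral over `t` against `h dν` of the lattice sum of `thetaTerm i a b`. -/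
def thetaIntegral (ν : Measure ℝ) (i a b : ℕ) (h : ℝ → ℂ) (z : ℂ) : ℂ :=
  ∫ x, thetaIntegrand i a b h z x ∂(ν.prod Measure.count)

/-- The lattice sum of `thetaTerm i a b`. -/
def thetaSeries (i a b : ℕ) (z : ℂ) (t : ℝ) : ℂ :=
  ∑' p : NonzeroPair, thetaTerm i a b p z t

section thetaIntegral

variable {ν : Measure ℝ} {h : ℝ → ℂ}

lemma measurable_thetaTerm (i a b : ℕ) (z : ℂ) :
    Measurable fun x : ℝ × NonzeroPair => thetaTerm i a b x.2 z x.1 := by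
  refine measurable_from_prod_countable_left fun p => Continuous.measurable ?_
  unfold thetaTerm
  fun_prop

lemma aestronglyMeasurable_thetaIntegrand (hh : AEStronglyMeasurable h ν) (i a b : ℕ) (z : ℂ) :
    AEStronglyMeasurable (thetaIntegrand i a b h z) (ν.prod Measure.count) :=
  hh.comp_fst.mul (measurable_thetaTerm i a b z).aestronglyMeasurable

lemma ae_prod_count_pos (hν : ∀ᵐ t ∂ν, 0 < t) :
    ∀ᵐ x ∂(ν.prod (Measure.count : Measure NonzeroPair)), 0 < x.1 :=
  Measure.quasiMeasurePreserving_fst.ae hν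

lemma exists_norm_thetaIntegrand_le (hν : ∀ᵐ t ∂ν, 0 < t) (hh : Admissible ν h) (i a b : ℕ)
    (A : ℝ) {B : ℝ} (hB : 0 < B) :
    ∃ (N : ℕ) (g : ℝ × NonzeroPair → ℝ), Integrable g (ν.prod Measure.count) ∧
      ∀ᵐ x ∂(ν.prod Measure.count), ∀ z : ℂ, |z.re| ≤ A → B ≤ z.im →
        ‖thetaIntegrand i a b h z x‖ ≤ z.im ^ N * g x := by
  obtain ⟨-, N₀, hN⟩ := hh
  set N := N₀ + (i + a + b + 3)
  obtain ⟨C, -, hC⟩ := exists_norm_thetaTerm_le i a b N (by omega) A hB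
  refine ⟨N, fun x => (C * (‖h x.1‖ * (x.1 ^ N)⁻¹)) * (‖x.2.1‖ ^ 3)⁻¹, ?_, ?_⟩
  · refine Integrable.mul_prod (g := fun p : NonzeroPair => (‖p.1‖ ^ 3)⁻¹)
      ((hN N (by omega)).const_mul C) (integrable_count_iff.2 ?_)
    exact summable_norm_prod_int_cube_inv.congr fun p => by simp
  · filter_upwards [ae_prod_count_pos hν] with x hx z hzA hzB
    calc ‖thetaIntegrand i a b h z x‖
        = ‖h x.1‖ * ‖thetaTerm i a b x.2 z x.1‖ := norm_mul _ _
      _ ≤ ‖h x.1‖ * (C * (z.im / x.1) ^ N * (‖x.2.1‖ ^ 3)⁻¹) := by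
          gcongr
          exact hC z hzA hzB _ x.2.2 _ hx
      _ = _ := by
          rw [div_pow]
          ring

lemma dominatedNear_thetaIntegrand (hν : ∀ᵐ t ∂ν, 0 < t) (hh : Admissible ν h) (i a b : ℕ) {z : ℂ}
    (hz : 0 < z.im) :
    DominatedNear (ν.prod Measure.count) (thetaIntegrand i a b h) z := by
  obtain ⟨N, g, hg, hle⟩ :=
    exists_norm_thetaIntegrand_le hν hh i a b (|z.re| + 1) (half_pos hz)
  refine ⟨{w | |w.re| < |z.re| + 1 ∧ z.im / 2 < w.im ∧ w.im < z.im + 1}, ?_,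
    fun x => (z.im + 1) ^ N * |g x|, hg.abs.const_mul _, ?_⟩
  · exact (Complex.continuous_re.abs.continuousAt.eventually_lt_const (lt_add_one _)).and
      ((Complex.continuous_im.continuousAt.eventually_const_lt (half_lt_self hz)).and
        (Complex.continuous_im.continuousAt.eventually_lt_const (lt_add_one _)))
  · filter_upwards [hle] with x hx w ⟨hre, him, him'⟩
    have hw : 0 < w.im := (half_pos hz).trans him
    calc ‖thetaIntegrand i a b h w x‖ ≤ w.im ^ N * g x := hx w hre.le him.le
      _ ≤ w.im ^ N * |g x| := by
        gcongr
        exact le_abs_self _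
      _ ≤ (z.im + 1) ^ N * |g x| := by gcongr

lemma integrable_thetaIntegrand (hν : ∀ᵐ t ∂ν, 0 < t) (hh : Admissible ν h) (i a b : ℕ) {z : ℂ}
    (hz : 0 < z.im) : Integrable (thetaIntegrand i a b h z) (ν.prod Measure.count) :=
  (dominatedNear_thetaIntegrand hν hh i a b hz).integrable
    (aestronglyMeasurable_thetaIntegrand hh.1 i a b z)

lemma thetaIntegral_eq_integral_thetaSeries [SFinite ν] (hν : ∀ᵐ t ∂ν, 0 < t)
    (hh : Admissible ν h) (i a b : ℕ) {z : ℂ} (hz : 0 < z.im) :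
    thetaIntegral ν i a b h z = ∫ t, h t * thetaSeries i a b z t ∂ν := by
  have hi := integrable_thetaIntegrand hν hh i a b hz
  rw [thetaIntegral, integral_prod _ hi]
  refine integral_congr_ae ?_
  filter_upwards [hi.prod_right_ae] with t ht
  rw [integral_countable ht, thetaSeries, ← tsum_mul_left]
  simp [thetaIntegrand]

lemma hasWirtingerDerivAt_thetaIntegrand (i a b : ℕ) (h : ℝ → ℂ) {z : ℂ} (hz : 0 < z.im)
    (x : ℝ × NonzeroPair) :
    HasWirtingerDerivAt (fun w => thetaIntegrand i a b h w x)
      (a * thetaIntegrand (i + 1) (a - 1) b h z x +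
        -(Complex.I / 2 * Real.pi) * ((z.im : ℂ)⁻¹) ^ 2 *
          thetaIntegrand i a (b + 2) (fun t => t * h t) z x)
      (b * thetaIntegrand (i + 1) a (b - 1) h z x +
        Complex.I / 2 * Real.pi * ((z.im : ℂ)⁻¹) ^ 2 *
          thetaIntegrand i (a + 2) b (fun t => t * h t) z x) z := by
  refine ((hasWirtingerDerivAt_thetaTerm i a b x.2 hz x.1).const_mul (h x.1)).congr_deriv ?_ ?_
  · simp only [thetaIntegrand]
    ring
  · simp only [thetaIntegrand]
    ring

lemma hasWirtingerDerivAt_thetaIntegral (hν : ∀ᵐ t ∂ν, 0 < t) (hh : Admissible ν h) (i a b : ℕ)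
    {z : ℂ} (hz : 0 < z.im) :
    HasWirtingerDerivAt (thetaIntegral ν i a b h)
      (a * thetaIntegral ν (i + 1) (a - 1) b h z +
        -(Complex.I / 2 * Real.pi) * ((z.im : ℂ)⁻¹) ^ 2 *
          thetaIntegral ν i a (b + 2) (fun t => t * h t) z)
      (b * thetaIntegral ν (i + 1) a (b - 1) h z +
        Complex.I / 2 * Real.pi * ((z.im : ℂ)⁻¹) ^ 2 *
          thetaIntegral ν i (a + 2) b (fun t => t * h t) z) z := by
  have hh' := hh.mul_id hν
  have hy : (z.im : ℂ) ≠ 0 := ofReal_ne_zero.2 hz.ne'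
  have hc (c : ℂ) : ContinuousAt (fun w : ℂ => c * ((w.im : ℂ)⁻¹) ^ 2) z :=
    (((continuous_ofReal.comp Complex.continuous_im).continuousAt.inv₀ hy).pow 2).const_mul c
  have hdom {h : ℝ → ℂ} (hh : Admissible ν h) (i a b : ℕ) :=
    dominatedNear_thetaIntegrand hν hh i a b hz
  have hint {h : ℝ → ℂ} (hh : Admissible ν h) (i a b : ℕ) :=
    integrable_thetaIntegrand hν hh i a b hz
  have hintA := ((hint hh (i + 1) (a - 1) b).const_mul (a : ℂ)).add
    ((hint hh' i a (b + 2)).const_mul (-(Complex.I / 2 * Real.pi) * ((z.im : ℂ)⁻¹) ^ 2))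
  have hintB := ((hint hh (i + 1) a (b - 1)).const_mul (b : ℂ)).add
    ((hint hh' i (a + 2) b).const_mul (Complex.I / 2 * Real.pi * ((z.im : ℂ)⁻¹) ^ 2))
  refine (HasWirtingerDerivAt.integral (isOpen_upperHalfPlaneSet.mem_nhds hz)
    (aestronglyMeasurable_thetaIntegrand hh.1 i a b) (hint hh i a b)
    (((hdom hh (i + 1) (a - 1) b).mul_left continuousAt_const).add
      ((hdom hh' i a (b + 2)).mul_left (hc _))) hintA.aestronglyMeasurable
    (((hdom hh (i + 1) a (b - 1)).mul_left continuousAt_const).add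
      ((hdom hh' i (a + 2) b).mul_left (hc _))) hintB.aestronglyMeasurable
    (.of_forall fun x w hw => hasWirtingerDerivAt_thetaIntegrand i a b h hw x)).congr_deriv ?_ ?_
  · rw [integral_add ((hint hh _ _ _).const_mul _) ((hint hh' _ _ _).const_mul _),
      integral_const_mul, integral_const_mul]
    rfl
  · rw [integral_add ((hint hh _ _ _).const_mul _) ((hint hh' _ _ _).const_mul _),
      integral_const_mul, integral_const_mul]
    rfl

lemma contDiffOn_thetaIntegral (hν : ∀ᵐ t ∂ν, 0 < t) (hh : Admissible ν h) (i a b : ℕ) :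
    ContDiffOn ℝ ∞ (thetaIntegral ν i a b h) upperHalfPlaneSet := by
  rw [contDiffOn_infty]
  intro n
  induction n generalizing i a b h with
  | zero =>
    exact contDiffOn_zero.2 fun z hz =>
      (hasWirtingerDerivAt_thetaIntegral hν hh i a b hz).continuousAt.continuousWithinAt
  | succ n ih =>
    have hinv : ContDiffOn ℝ n (fun z : ℂ => ((z.im : ℂ)⁻¹) ^ 2) upperHalfPlaneSet :=
      ((ofRealCLM.comp imCLM).contDiff.contDiffOn.inv
        fun z hz => ofReal_ne_zero.2 (ne_of_gt hz)).pow 2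
    have hh' := hh.mul_id hν
    have hd (z : ℂ) (hz : z ∈ upperHalfPlaneSet) : HasFDerivAt _ _ z :=
      hasWirtingerDerivAt_thetaIntegral hν hh i a b hz
    push_cast
    rw [contDiffOn_succ_iff_fderiv_of_isOpen isOpen_upperHalfPlaneSet]
    refine ⟨fun z hz => (hd z hz).differentiableAt.differentiableWithinAt, by simp, ?_⟩
    refine ContDiffOn.congr ?_ fun z hz => (hd z hz).fderiv
    exact (((contDiffOn_const.mul (ih hh _ _ _)).add
      ((contDiffOn_const.mul hinv).mul (ih hh' _ _ _))).smul contDiffOn_const).add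
        (((contDiffOn_const.mul (ih hh _ _ _)).add
          ((contDiffOn_const.mul hinv).mul (ih hh' _ _ _))).smul contDiffOn_const)

end thetaIntegral

section thetaSeries

lemma summable_thetaTerm (i a b : ℕ) {z : ℂ} (hz : 0 < z.im) {t : ℝ} (ht : 0 < t) :
    Summable fun p : NonzeroPair => thetaTerm i a b p z t := by
  obtain ⟨C, -, hC⟩ := exists_norm_thetaTerm_le i a b (i + a + b + 3) (by omega) |z.re| hz
  exact Summable.of_norm_bounded (summable_norm_prod_int_cube_inv.mul_left (C * (z.im / t) ^ _))
    fun p => hC z le_rfl le_rfl p.1 p.2 t ht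

lemma ae_dirac_pos {t : ℝ} (ht : 0 < t) : ∀ᵐ u ∂(Measure.dirac t), 0 < u :=
  (ae_dirac_iff measurableSet_Ioi).2 ht

lemma admissible_dirac (t : ℝ) (h : ℝ → ℂ) : Admissible (Measure.dirac t) h :=
  ⟨aestronglyMeasurable_dirac, 0, fun _ _ => integrable_dirac enorm_lt_top⟩

lemma thetaIntegral_dirac (i a b : ℕ) (h : ℝ → ℂ) {z : ℂ} (hz : 0 < z.im) {t : ℝ} (ht : 0 < t) :
    thetaIntegral (Measure.dirac t) i a b h z = h t * thetaSeries i a b z t := by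
  rw [thetaIntegral_eq_integral_thetaSeries (ae_dirac_pos ht) (admissible_dirac t h) i a b hz,
    integral_dirac]

lemma hasWirtingerDerivAt_thetaSeries (i a b : ℕ) {z : ℂ} (hz : 0 < z.im) {t : ℝ} (ht : 0 < t) :
    HasWirtingerDerivAt (fun w => thetaSeries i a b w t)
      (a * thetaSeries (i + 1) (a - 1) b z t -
        Complex.I / 2 * Real.pi * ((z.im : ℂ)⁻¹) ^ 2 * (t * thetaSeries i a (b + 2) z t))
      (b * thetaSeries (i + 1) a (b - 1) z t +
        Complex.I / 2 * Real.pi * ((z.im : ℂ)⁻¹) ^ 2 * (t * thetaSeries i (a + 2) b z t)) z := by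
  refine ((hasWirtingerDerivAt_thetaIntegral (ae_dirac_pos ht) (admissible_dirac t fun _ => 1)
    i a b hz).congr_deriv ?_ ?_).congr_of_eventuallyEq ?_
  · simp only [thetaIntegral_dirac _ _ _ _ hz ht]
    ring
  · simp only [thetaIntegral_dirac _ _ _ _ hz ht]
    ring
  · filter_upwards [isOpen_upperHalfPlaneSet.mem_nhds hz] with w hw
    rw [thetaIntegral_dirac _ _ _ _ hw ht, one_mul]

/-- The summand `exp (-π t y m² - π y n² / t - 2 π i m n x)` obtained from `thetaTerm 0 0 0` by
Poisson summation over `n`. -/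
def poissonTerm (p : ℤ × ℤ) (z : ℂ) (t : ℝ) : ℂ :=
  cexp (-Real.pi * (t * z.im) * p.1 ^ 2 + -Real.pi * (z.im / t) * p.2 ^ 2 -
    2 * Real.pi * Complex.I * (p.1 * p.2 * z.re))

lemma poissonTerm_inv (p : ℤ × ℤ) (z : ℂ) (t : ℝ) :
    poissonTerm p z t⁻¹ = poissonTerm p.swap z t := by
  simp only [poissonTerm, Prod.fst_swap, Prod.snd_swap]
  congr 1
  push_cast
  rw [div_inv_eq_mul]
  ring

lemma summable_exp_neg_mul_int_sq {c : ℝ} (hc : 0 < c) :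
    Summable fun n : ℤ => Real.exp (-Real.pi * c * n ^ 2) := by
  refine ((summable_jacobiTheta₂_term_iff 0 (c * Complex.I)).2 (by simpa using hc)).norm.congr
    fun n => ?_
  rw [norm_jacobiTheta₂_term]
  congr 1
  simp only [mul_I_im, ofReal_re, Complex.zero_im, mul_zero, sub_zero]
  ring

lemma norm_poissonTerm (p : ℤ × ℤ) (z : ℂ) (t : ℝ) :
    ‖poissonTerm p z t‖ = Real.exp (-Real.pi * (t * z.im) * p.1 ^ 2) *
      Real.exp (-Real.pi * (z.im / t) * p.2 ^ 2) := by
  have hsplit : (-Real.pi * (t * z.im) * p.1 ^ 2 + -Real.pi * (z.im / t) * p.2 ^ 2 -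
      2 * Real.pi * Complex.I * (p.1 * p.2 * z.re) : ℂ) =
      ((-Real.pi * (t * z.im) * p.1 ^ 2 + -Real.pi * (z.im / t) * p.2 ^ 2 : ℝ) : ℂ) +
        ((-(2 * Real.pi * (p.1 * p.2 * z.re)) : ℝ) : ℂ) * Complex.I := by
    push_cast
    ring
  rw [poissonTerm, hsplit, Complex.exp_add, norm_mul, norm_exp_ofReal, norm_exp_ofReal_mul_I,
    mul_one, Real.exp_add]

lemma summable_poissonTerm {z : ℂ} (hz : 0 < z.im) {t : ℝ} (ht : 0 < t) :
    Summable fun p : ℤ × ℤ => poissonTerm p z t := by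
  have hm := summable_exp_neg_mul_int_sq (c := t * z.im) (by positivity)
  have hn := summable_exp_neg_mul_int_sq (c := z.im / t) (by positivity)
  exact Summable.of_norm ((hm.mul_of_nonneg hn (fun _ => by positivity)
    fun _ => by positivity).congr fun p => (norm_poissonTerm p z t).symm)

lemma thetaTerm_zero_eq (m n : ℤ) {z : ℂ} (hz : 0 < z.im) (t : ℝ) :
    thetaTerm 0 0 0 (m, n) z t =
      cexp (-Real.pi * (t * z.im) * m ^ 2) * cexp (-Real.pi / (z.im / t) * (n + m * z.re) ^ 2) := by
  have hy : (z.im : ℂ) ≠ 0 := ofReal_ne_zero.2 hz.ne'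
  have hnormSq : linForm (m, n) z * starRingEnd ℂ (linForm (m, n) z) =
      (m * z.re + n) ^ 2 + m ^ 2 * z.im ^ 2 := by
    rw [mul_conj, normSq_apply]
    simp [linForm]
    ring
  rw [← Complex.exp_add, thetaTerm, hnormSq]
  simp only [pow_zero, one_mul]
  congr 1
  field_simp
  ring

lemma tsum_thetaTerm_zero_eq (m : ℤ) {z : ℂ} (hz : 0 < z.im) {t : ℝ} (ht : 0 < t) :
    ∑' n : ℤ, thetaTerm 0 0 0 (m, n) z t =
      (Real.sqrt (z.im / t) : ℂ) * ∑' n : ℤ, poissonTerm (m, n) z t := by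
  have hyt : 0 < z.im / t := by positivity
  have hsqrt : ((z.im / t : ℝ) : ℂ) ^ (1 / 2 : ℂ) = (Real.sqrt (z.im / t) : ℂ) := by
    rw [Real.sqrt_eq_rpow, ofReal_cpow hyt.le]
    norm_num
  have hsqrt0 : (Real.sqrt (z.im / t) : ℂ) ≠ 0 := ofReal_ne_zero.2 (Real.sqrt_pos.2 hyt).ne'
  have hshift (n : ℤ) : (n + Complex.I * (-Complex.I * (m * z.re)) : ℂ) = n + m * z.re := by
    linear_combination -(m * z.re : ℂ) * I_sq
  have hpoisson := Complex.tsum_exp_neg_quadratic (a := ((z.im / t : ℝ) : ℂ))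
    (by simpa using hyt) (-Complex.I * (m * z.re))
  simp only [hsqrt, hshift] at hpoisson
  simp only [thetaTerm_zero_eq m _ hz, tsum_mul_left]
  rw [← ofReal_div, ← inv_mul_eq_iff_eq_mul₀ hsqrt0, mul_left_comm, ← one_div, ← hpoisson,
    ← tsum_mul_left]
  refine tsum_congr fun n => ?_
  rw [poissonTerm, ← Complex.exp_add]
  congr 1
  push_cast
  ring

lemma summable_thetaTerm_prod (a : ℕ) {z : ℂ} (hz : 0 < z.im) {t : ℝ} (ht : 0 < t) :
    Summable fun p : ℤ × ℤ => thetaTerm 0 a 0 p z t :=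
  (Finset.summable_compl_iff {(0 : ℤ × ℤ)}).1
    ((Equiv.subtypeEquivRight fun p => by simp).summable_iff.2 (summable_thetaTerm 0 a 0 hz ht))

lemma tsum_thetaTerm_prod_eq {z : ℂ} (hz : 0 < z.im) {t : ℝ} (ht : 0 < t) :
    ∑' p : ℤ × ℤ, thetaTerm 0 0 0 p z t =
      (Real.sqrt (z.im / t) : ℂ) * ∑' p : ℤ × ℤ, poissonTerm p z t := by
  rw [(summable_thetaTerm_prod 0 hz ht).tsum_prod, (summable_poissonTerm hz ht).tsum_prod,
    ← tsum_mul_left]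
  exact tsum_congr fun m => tsum_thetaTerm_zero_eq m hz ht

lemma tsum_thetaTerm_prod_inv {z : ℂ} (hz : 0 < z.im) {t : ℝ} (ht : 0 < t) :
    ∑' p : ℤ × ℤ, thetaTerm 0 0 0 p z t⁻¹ = t * ∑' p : ℤ × ℤ, thetaTerm 0 0 0 p z t := by
  have hsqrt : Real.sqrt (z.im / t⁻¹) = t * Real.sqrt (z.im / t) := by
    rw [show z.im / t⁻¹ = t ^ 2 * (z.im / t) by field_simp, Real.sqrt_mul (by positivity),
      Real.sqrt_sq ht.le]
  have hswap : ∑' p : ℤ × ℤ, poissonTerm p z t⁻¹ = ∑' p : ℤ × ℤ, poissonTerm p z t := by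
    simp only [poissonTerm_inv]
    exact (Equiv.prodComm ℤ ℤ).tsum_eq fun p => poissonTerm p z t
  rw [tsum_thetaTerm_prod_eq hz ht, tsum_thetaTerm_prod_eq hz (inv_pos.2 ht), hsqrt, hswap,
    ofReal_mul, mul_assoc]

lemma tsum_thetaTerm_prod_eq_one_add {z : ℂ} (hz : 0 < z.im) {t : ℝ} (ht : 0 < t) :
    ∑' p : ℤ × ℤ, thetaTerm 0 0 0 p z t = 1 + thetaSeries 0 0 0 z t := by
  rw [← (summable_thetaTerm_prod 0 hz ht).sum_add_tsum_subtype_compl {(0 : ℤ × ℤ)}]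
  congr 1
  · simp [thetaTerm, linForm]
  · exact (Equiv.subtypeEquivRight fun p : ℤ × ℤ => by simp).tsum_eq
      fun p : NonzeroPair => thetaTerm 0 0 0 p.1 z t

lemma thetaSeries_zero_inv {z : ℂ} (hz : 0 < z.im) {t : ℝ} (ht : 0 < t) :
    thetaSeries 0 0 0 z t⁻¹ = t * thetaSeries 0 0 0 z t + (t - 1) := by
  have h := tsum_thetaTerm_prod_inv hz ht
  rw [tsum_thetaTerm_prod_eq_one_add hz ht, tsum_thetaTerm_prod_eq_one_add hz (inv_pos.2 ht)] at h
  linear_combination h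

-- `∂/∂z̄` turns the series of `w ^ a` into that of `w ^ (a + 2)` and removes the constant `d`.
lemma thetaSeries_add_two_inv {a : ℕ} {t : ℝ} (ht : 0 < t) {c d : ℂ}
    (h : ∀ w : ℂ, 0 < w.im → thetaSeries 0 a 0 w t⁻¹ = c * thetaSeries 0 a 0 w t + d)
    {z : ℂ} (hz : 0 < z.im) :
    thetaSeries 0 (a + 2) 0 z t⁻¹ = t ^ 2 * c * thetaSeries 0 (a + 2) 0 z t := by
  have hy : (z.im : ℂ) ≠ 0 := ofReal_ne_zero.2 hz.ne'
  have htc : (t : ℂ) ≠ 0 := ofReal_ne_zero.2 ht.ne'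
  have hpi : (Real.pi : ℂ) ≠ 0 := ofReal_ne_zero.2 Real.pi_ne_zero
  have hderiv := (hasWirtingerDerivAt_thetaSeries 0 a 0 hz (inv_pos.2 ht)).unique_conj
    ((((hasWirtingerDerivAt_thetaSeries 0 a 0 hz ht).const_mul c).add
      (.const d)).congr_of_eventuallyEq (by
        filter_upwards [isOpen_upperHalfPlaneSet.mem_nhds hz] with w hw using h w hw))
  simp only [Nat.cast_zero, zero_mul, zero_add, add_zero, ofReal_inv] at hderiv
  field_simp at hderiv
  rwa [one_div] at hderiv

lemma thetaSeries_zero_right_inv {a : ℕ} (ha : Even a) (ha0 : a ≠ 0) {z : ℂ} (hz : 0 < z.im) {t : ℝ}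
    (ht : 0 < t) :
    thetaSeries 0 a 0 z t⁻¹ = (t : ℂ) ^ (a + 1) * thetaSeries 0 a 0 z t := by
  obtain ⟨j, rfl⟩ : ∃ j, a = 2 * j + 2 := by
    obtain ⟨r, rfl⟩ := ha
    exact ⟨r - 1, by omega⟩
  clear ha ha0
  induction j generalizing z with
  | zero =>
    rw [thetaSeries_add_two_inv ht (fun w hw => thetaSeries_zero_inv hw ht) hz]
    ring
  | succ j ih =>
    rw [show 2 * (j + 1) + 2 = 2 * j + 2 + 2 by ring,
      thetaSeries_add_two_inv ht (d := 0) (fun w hw => by rw [ih hw, add_zero]) hz]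
    ring

theorem thetaSeries_inv {a b : ℕ} (hab : a = 0 ∨ b = 0) (heven : Even (a + b)) (hne : a + b ≠ 0)
    {z : ℂ} (hz : 0 < z.im) {t : ℝ} (ht : 0 < t) :
    thetaSeries 0 a b z t⁻¹ = (t : ℂ) ^ (a + b + 1) * thetaSeries 0 a b z t := by
  rcases hab with rfl | rfl
  · rw [zero_add] at *
    have h := congrArg (starRingEnd ℂ) (thetaSeries_zero_right_inv heven hne hz ht)
    simpa only [thetaSeries, map_mul, map_pow, conj_ofReal, Complex.conj_tsum, conj_thetaTerm]
      using h
  · exact thetaSeries_zero_right_inv heven hne hz ht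

end thetaSeries

/-- Lebesgue measure on `(1, ∞)`. -/
def tailMeasure : Measure ℝ := volume.restrict (Set.Ioi 1)

instance : SFinite tailMeasure := inferInstanceAs (SFinite (volume.restrict (Set.Ioi 1)))

lemma ae_tailMeasure_one_lt : ∀ᵐ t ∂tailMeasure, 1 < t :=
  ae_restrict_mem measurableSet_Ioi

lemma ae_tailMeasure_pos : ∀ᵐ t ∂tailMeasure, 0 < t :=
  ae_tailMeasure_one_lt.mono fun _ h => one_pos.trans h

/-- The weight function `t ^ s (log t) ^ n`, the `n`-th derivative in `s` of `t ^ s`. -/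
def cpowMulLogPow (s : ℂ) (n : ℕ) (t : ℝ) : ℂ := (t : ℂ) ^ s * (Real.log t : ℂ) ^ n

lemma norm_cpowMulLogPow (s : ℂ) (n : ℕ) {t : ℝ} (ht : 1 < t) :
    ‖cpowMulLogPow s n t‖ = t ^ s.re * Real.log t ^ n := by
  rw [cpowMulLogPow, norm_mul, norm_cpow_eq_rpow_re_of_pos (one_pos.trans ht), norm_pow,
    norm_real, Real.norm_of_nonneg (Real.log_pos ht).le]

lemma measurable_cpowMulLogPow (s : ℂ) (n : ℕ) : Measurable (cpowMulLogPow s n) := by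
  unfold cpowMulLogPow
  fun_prop

lemma hasDerivAt_cpowMulLogPow (s : ℂ) (n : ℕ) {t : ℝ} (ht : 0 < t) :
    HasDerivAt (fun s => cpowMulLogPow s n t) (cpowMulLogPow s (n + 1) t) s := by
  have ht' : (t : ℂ) ≠ 0 := ofReal_ne_zero.2 ht.ne'
  refine (((hasDerivAt_id s).const_cpow (Or.inl ht')).mul_const _).congr_deriv ?_
  rw [cpowMulLogPow, ofReal_log ht.le, id]
  ring

lemma conj_cpowMulLogPow (s : ℂ) (n : ℕ) {t : ℝ} (ht : 0 < t) :
    starRingEnd ℂ (cpowMulLogPow s n t) = cpowMulLogPow (starRingEnd ℂ s) n t := by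
  have harg : arg (t : ℂ) ≠ Real.pi := by
    rw [arg_ofReal_of_nonneg ht.le]
    exact Real.pi_pos.ne
  rw [cpowMulLogPow, cpowMulLogPow, map_mul, map_pow, conj_ofReal, cpow_conj _ _ harg, conj_ofReal]

lemma admissible_cpowMulLogPow (s : ℂ) (n : ℕ) : Admissible tailMeasure (cpowMulLogPow s n) := by
  refine ⟨(measurable_cpowMulLogPow s n).aestronglyMeasurable, ⌈s.re⌉₊ + n + 2, fun N hN => ?_⟩
  have hlt : s.re + n - N < -1 := by
    have h1 := Nat.le_ceil s.re
    have h2 : ((⌈s.re⌉₊ + n + 2 : ℕ) : ℝ) ≤ N := by exact_mod_cast hN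
    push_cast at h2
    linarith
  refine (integrableOn_Ioi_rpow_of_lt hlt one_pos).mono' ?_ ?_
  · exact ((measurable_cpowMulLogPow s n).norm.mul (by fun_prop)).aestronglyMeasurable
  · filter_upwards [ae_tailMeasure_one_lt] with t ht
    have ht0 : 0 < t := one_pos.trans ht
    have hlog := Real.log_pos ht
    rw [norm_cpowMulLogPow s n ht, Real.norm_of_nonneg (by positivity), Real.rpow_sub ht0,
      Real.rpow_add ht0, Real.rpow_natCast, Real.rpow_natCast, div_eq_mul_inv]
    gcongr
    exact Real.log_le_self ht0.le

/-- `∫_1^∞ t ^ s (log t) ^ n ∑ m ^ i w ^ a w̄ ^ b exp (-π t |w|² / y) dt`, where `w = m z + n`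
runs over the nonzero lattice vectors. -/
def tailTheta (i a b n : ℕ) (s z : ℂ) : ℂ :=
  thetaIntegral tailMeasure i a b (cpowMulLogPow s n) z

section tailTheta

variable (i a b n : ℕ) (s : ℂ) {z : ℂ}

lemma thetaIntegral_mul_cpowMulLogPow (z : ℂ) :
    thetaIntegral tailMeasure i a b (fun t => t * cpowMulLogPow s n t) z =
      tailTheta i a b n (s + 1) z := by
  refine integral_congr_ae ?_
  filter_upwards [ae_prod_count_pos ae_tailMeasure_pos] with x hx
  rw [thetaIntegrand, thetaIntegrand, cpowMulLogPow, cpowMulLogPow,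
    cpow_add _ _ (ofReal_ne_zero.2 hx.ne'), cpow_one]
  ring

lemma hasWirtingerDerivAt_tailTheta (hz : 0 < z.im) :
    HasWirtingerDerivAt (tailTheta i a b n s)
      (a * tailTheta (i + 1) (a - 1) b n s z +
        -(Complex.I / 2 * Real.pi) * ((z.im : ℂ)⁻¹) ^ 2 * tailTheta i a (b + 2) n (s + 1) z)
      (b * tailTheta (i + 1) a (b - 1) n s z +
        Complex.I / 2 * Real.pi * ((z.im : ℂ)⁻¹) ^ 2 * tailTheta i (a + 2) b n (s + 1) z) z := by
  simp only [← thetaIntegral_mul_cpowMulLogPow]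
  exact hasWirtingerDerivAt_thetaIntegral ae_tailMeasure_pos (admissible_cpowMulLogPow s n) i a b hz

lemma contDiffOn_tailTheta : ContDiffOn ℝ ∞ (tailTheta i a b n s) upperHalfPlaneSet :=
  contDiffOn_thetaIntegral ae_tailMeasure_pos (admissible_cpowMulLogPow s n) i a b

lemma conj_tailTheta (z : ℂ) :
    starRingEnd ℂ (tailTheta i a b n s z) = tailTheta i b a n (starRingEnd ℂ s) z := by
  rw [tailTheta, thetaIntegral, ← integral_conj]
  refine integral_congr_ae ?_
  filter_upwards [ae_prod_count_pos ae_tailMeasure_pos] with x hx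
  rw [thetaIntegrand, map_mul, conj_thetaTerm, conj_cpowMulLogPow s n hx, thetaIntegrand]

lemma exists_norm_tailTheta_le (A : ℝ) {B : ℝ} (hB : 0 < B) :
    ∃ (N : ℕ) (C : ℝ), ∀ z : ℂ, |z.re| ≤ A → B ≤ z.im →
      ‖tailTheta i a b n s z‖ ≤ C * z.im ^ N := by
  obtain ⟨N, g, hg, hle⟩ := exists_norm_thetaIntegrand_le ae_tailMeasure_pos
    (admissible_cpowMulLogPow s n) i a b A hB
  refine ⟨N, ∫ x, g x ∂(tailMeasure.prod Measure.count), fun z hA hz => ?_⟩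
  rw [mul_comm, ← integral_const_mul]
  exact norm_integral_le_of_norm_le (hg.const_mul _) (hle.mono fun x hx => hx z hA hz)

lemma hasDerivAt_tailTheta (hz : 0 < z.im) :
    HasDerivAt (fun s => tailTheta i a b n s z) (tailTheta i a b (n + 1) s z) s := by
  have hm (n : ℕ) (w : ℂ) := aestronglyMeasurable_thetaIntegrand (ν := tailMeasure)
    (measurable_cpowMulLogPow w n).aestronglyMeasurable i a b z
  have hint (n : ℕ) (w : ℂ) := integrable_thetaIntegrand ae_tailMeasure_pos
    (admissible_cpowMulLogPow w n) i a b hz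
  refine (hasDerivAt_integral_of_dominated_loc_of_deriv_le
    (F' := fun w => thetaIntegrand i a b (cpowMulLogPow w (n + 1)) z)
    (bound := fun x => ‖thetaIntegrand i a b (cpowMulLogPow (s.re + 1 : ℝ) (n + 1)) z x‖)
    (Metric.ball_mem_nhds s one_pos) (.of_forall fun w => hm n w) (hint n s) (hm (n + 1) s) ?_
    (hint _ _).norm ?_).2
  · filter_upwards [Measure.quasiMeasurePreserving_fst.ae ae_tailMeasure_one_lt] with x hx w hw
    have hlog := (Real.log_pos hx).le
    have hre : w.re ≤ s.re + 1 := by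
      have h1 := (le_abs_self _).trans (abs_re_le_norm (w - s))
      have h2 := mem_ball_iff_norm.1 hw
      rw [sub_re] at h1
      linarith
    rw [thetaIntegrand, thetaIntegrand, norm_mul, norm_mul, norm_cpowMulLogPow _ _ hx,
      norm_cpowMulLogPow _ _ hx, ofReal_re]
    gcongr
    exact hx.le
  · filter_upwards [ae_prod_count_pos ae_tailMeasure_pos] with x hx w _
    exact (hasDerivAt_cpowMulLogPow w n hx).mul_const _

lemma differentiable_tailTheta (hz : 0 < z.im) : Differentiable ℂ fun s => tailTheta i a b n s z :=
  fun s => (hasDerivAt_tailTheta i a b n s hz).differentiableAt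

lemma differentiable_tailTheta_add (c : ℂ) (hz : 0 < z.im) :
    Differentiable ℂ fun s => tailTheta i a b n (s + c) z :=
  (differentiable_tailTheta i a b n hz).comp (differentiable_id.add_const c)

lemma differentiable_tailTheta_sub (c : ℂ) (hz : 0 < z.im) :
    Differentiable ℂ fun s => tailTheta i a b n (c - s) z :=
  (differentiable_tailTheta i a b n hz).comp (differentiable_id.const_sub c)

lemma tailTheta_zero_eq (hz : 0 < z.im) :
    tailTheta i a b 0 s z = ∫ t in Set.Ioi (1 : ℝ), (t : ℂ) ^ s * thetaSeries i a b z t := by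
  rw [tailTheta, thetaIntegral_eq_integral_thetaSeries ae_tailMeasure_pos
    (admissible_cpowMulLogPow s 0) i a b hz]
  simp only [cpowMulLogPow, pow_zero, mul_one]
  rfl

lemma integrableOn_cpow_mul_thetaSeries (hz : 0 < z.im) :
    IntegrableOn (fun t : ℝ => (t : ℂ) ^ s * thetaSeries i a b z t) (Set.Ioi 1) := by
  have hi := integrable_thetaIntegrand ae_tailMeasure_pos (admissible_cpowMulLogPow s 0) i a b hz
  refine Integrable.congr hi.integral_prod_left ?_
  filter_upwards [hi.prod_right_ae] with t ht
  rw [integral_countable ht, thetaSeries, ← tsum_mul_left]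
  simp [thetaIntegrand, cpowMulLogPow]

end tailTheta

section mellin

variable {F : ℝ → ℂ}

lemma cpow_smul_indicator_Ioi_one (F : ℝ → ℂ) (s : ℂ) :
    (fun t : ℝ => (t : ℂ) ^ (s - 1) • (Set.Ioi 1).indicator F t) =
      (Set.Ioi 1).indicator fun t : ℝ => (t : ℂ) ^ (s - 1) * F t := by
  ext t
  by_cases ht : t ∈ Set.Ioi (1 : ℝ) <;> simp [ht]

lemma mellinConvergent_indicator_Ioi_one
    (hF : ∀ s : ℂ, IntegrableOn (fun t : ℝ => (t : ℂ) ^ s * F t) (Set.Ioi 1)) (s : ℂ) :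
    MellinConvergent ((Set.Ioi 1).indicator F) s := by
  rw [MellinConvergent, cpow_smul_indicator_Ioi_one, integrableOn_indicator_iff measurableSet_Ioi,
    Set.inter_eq_left.2 (Set.Ioi_subset_Ioi zero_le_one)]
  exact hF _

lemma mellin_indicator_Ioi_one (F : ℝ → ℂ) (s : ℂ) :
    mellin ((Set.Ioi 1).indicator F) s = ∫ t in Set.Ioi (1 : ℝ), (t : ℂ) ^ (s - 1) * F t := by
  rw [mellin, cpow_smul_indicator_Ioi_one, setIntegral_indicator measurableSet_Ioi,
    Set.inter_eq_right.2 (Set.Ioi_subset_Ioi zero_le_one)]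

lemma eq_indicator_Ioi_one_add_of_inv_eq {d : ℕ} {t : ℝ} (ht : 0 < t) (ht1 : t ≠ 1)
    (hF : F t⁻¹ = (t : ℂ) ^ d * F t) :
    F t = (Set.Ioi 1).indicator F t + (t : ℂ) ^ (-d : ℂ) • (Set.Ioi 1).indicator F t⁻¹ := by
  have htc : (t : ℂ) ^ d ≠ 0 := pow_ne_zero _ (ofReal_ne_zero.2 ht.ne')
  rcases lt_or_gt_of_ne ht1 with h | h
  · rw [Set.indicator_of_notMem (by simpa using h.le),
      Set.indicator_of_mem (Set.mem_Ioi.2 ((one_lt_inv₀ ht).2 h)), hF, cpow_neg, cpow_natCast,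
      zero_add, smul_eq_mul, inv_mul_cancel_left₀ htc]
  · rw [Set.indicator_of_mem (Set.mem_Ioi.2 h),
      Set.indicator_of_notMem (by simpa using inv_le_one_of_one_le₀ h.le), smul_zero, add_zero]

lemma mellin_eq_add_of_inv_eq {d : ℕ} (hF : ∀ t : ℝ, 0 < t → F t⁻¹ = (t : ℂ) ^ d * F t)
    (hF_int : ∀ s : ℂ, IntegrableOn (fun t : ℝ => (t : ℂ) ^ s * F t) (Set.Ioi 1)) (s : ℂ) :
    mellin F s = (∫ t in Set.Ioi (1 : ℝ), (t : ℂ) ^ (s - 1) * F t) +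
      ∫ t in Set.Ioi (1 : ℝ), (t : ℂ) ^ (d - s - 1) * F t := by
  have hconv := mellinConvergent_indicator_Ioi_one hF_int
  set g : ℝ → ℂ := fun t => (t : ℂ) ^ (-d : ℂ) • (Set.Ioi 1).indicator F t⁻¹ with hg
  have hg_conv : MellinConvergent g s := by
    rw [hg, MellinConvergent.cpow_smul]
    simpa only [Real.rpow_neg_one] using
      (MellinConvergent.comp_rpow (s := s + -(d : ℂ)) (a := -1) (by norm_num)).2 (hconv _)
  have hg_mellin : mellin g s = ∫ t in Set.Ioi (1 : ℝ), (t : ℂ) ^ (d - s - 1) * F t := by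
    rw [hg, mellin_cpow_smul, mellin_comp_inv, mellin_indicator_Ioi_one, neg_add_rev, neg_neg,
      sub_eq_add_neg (d : ℂ) s]
  rw [← hg_mellin, ← mellin_indicator_Ioi_one, ← (hasMellin_add (hconv s) hg_conv).2]
  refine setIntegral_congr_ae measurableSet_Ioi ?_
  filter_upwards [Measure.ae_ne volume 1] with t ht1 ht
  rw [eq_indicator_Ioi_one_add_of_inv_eq ht ht1 (hF t ht)]

end mellin

lemma norm_linForm_pos {z : ℂ} (hz : 0 < z.im) {p : ℤ × ℤ} (hp : p ≠ 0) : 0 < ‖linForm p z‖ := by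
  obtain ⟨r, hr, h⟩ := exists_mul_norm_le_norm_linForm |z.re| hz
  have := one_le_norm_of_ne_zero hp
  exact lt_of_lt_of_le (by positivity) (h z le_rfl le_rfl p hp)

lemma summable_norm_linForm_rpow {z : ℂ} (hz : 0 < z.im) {σ : ℝ} (hσ : 2 < σ) :
    Summable fun p : NonzeroPair => ‖linForm p z‖ ^ (-σ) := by
  obtain ⟨r, hr, h⟩ := exists_mul_norm_le_norm_linForm |z.re| hz
  refine Summable.of_nonneg_of_le (fun p => by positivity) (fun p => ?_)
    ((summable_norm_prod_int_rpow hσ).mul_left (r ^ (-σ)))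
  have hp : 0 < ‖p.1‖ := one_pos.trans_le (one_le_norm_of_ne_zero p.2)
  rw [← Real.mul_rpow hr.le hp.le]
  exact Real.rpow_le_rpow_of_nonpos (by positivity) (h z le_rfl le_rfl p.1 p.2) (by linarith)

/-- The summand of `eisensteinSeries k` attached to `p = (m, n)`. -/
def eisensteinTerm (k : ℤ) (p : ℤ × ℤ) (z s : ℂ) : ℂ :=
  (z.im : ℂ) ^ s / (((‖linForm p z‖ : ℝ) : ℂ) ^ (2 * s) * linForm p z ^ k)

lemma eisensteinSeries_eq_tsum (k : ℤ) (z : ℍ) (s : ℂ) :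
    eisensteinSeries k z s = 1 / 2 * ∑' p : NonzeroPair, eisensteinTerm k p z s := rfl

lemma cpow_norm_sq_div {w y : ℝ} (hw : 0 < w) (hy : 0 < y) (s : ℂ) :
    ((w ^ 2 / y : ℝ) : ℂ) ^ s = (w : ℂ) ^ (2 * s) / (y : ℂ) ^ s := by
  rw [ofReal_div, div_cpow_ofReal_nonneg (by positivity) hy.le, pow_two, ofReal_mul,
    mul_cpow_ofReal_nonneg hw.le hw.le, two_mul, cpow_add _ _ (ofReal_ne_zero.2 hw.ne')]

lemma linForm_pow_mul_conj_pow_div (a b : ℕ) {z : ℂ} (hz : 0 < z.im) {p : ℤ × ℤ} (hp : p ≠ 0)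
    (s : ℂ) :
    linForm p z ^ a * starRingEnd ℂ (linForm p z) ^ b / ((‖linForm p z‖ ^ 2 / z.im : ℝ) : ℂ) ^ s =
      (z.im : ℂ) ^ b * eisensteinTerm (b - a) p z (s - b) := by
  have hw := norm_linForm_pos hz hp
  have hw0 : linForm p z ≠ 0 := norm_pos_iff.1 hw
  have hr : ((‖linForm p z‖ : ℝ) : ℂ) ≠ 0 := ofReal_ne_zero.2 hw.ne'
  have hy : (z.im : ℂ) ≠ 0 := ofReal_ne_zero.2 hz.ne'
  have hys : (z.im : ℂ) ^ s ≠ 0 := by simp [cpow_eq_zero_iff, hy]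
  have hrs : ((‖linForm p z‖ : ℝ) : ℂ) ^ (2 * s) ≠ 0 := by simp [cpow_eq_zero_iff, hw0]
  have hnormSq : ((‖linForm p z‖ : ℝ) : ℂ) ^ (2 * (b : ℂ)) =
      linForm p z ^ b * starRingEnd ℂ (linForm p z) ^ b := by
    rw [← mul_pow, mul_conj, normSq_eq_norm_sq, ofReal_pow, ← pow_mul, ← cpow_natCast]
    push_cast
    rfl
  have hconj : starRingEnd ℂ (linForm p z) ≠ 0 := by simpa using hw0
  rw [cpow_norm_sq_div hw hz, eisensteinTerm, cpow_sub _ _ hy, cpow_natCast, mul_sub,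
    cpow_sub _ _ hr, hnormSq, zpow_sub₀ hw0, zpow_natCast, zpow_natCast]
  field_simp

lemma summable_norm_linForm_pow_div (a b : ℕ) {z : ℂ} (hz : 0 < z.im) {σ : ℝ}
    (hσ : 1 + ((a + b : ℕ) : ℝ) / 2 < σ) :
    Summable fun p : NonzeroPair => ‖linForm p z ^ a * starRingEnd ℂ (linForm p z) ^ b‖ /
      (‖linForm p z‖ ^ 2 / z.im) ^ σ := by
  refine ((summable_norm_linForm_rpow hz (σ := 2 * σ - (a + b : ℕ)) (by linarith)).mul_left
    (z.im ^ σ)).congr fun p => ?_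
  have hw := norm_linForm_pos hz p.2
  rw [norm_mul, norm_pow, norm_pow, RCLike.norm_conj, ← pow_add,
    Real.div_rpow (by positivity) hz.le, ← Real.rpow_natCast _ 2, ← Real.rpow_mul hw.le,
    ← Real.rpow_natCast, neg_sub, Real.rpow_sub hw]
  push_cast
  field_simp

lemma mellin_thetaSeries (a b : ℕ) (z : ℍ) {s : ℂ} (hs : 1 + ((a + b : ℕ) : ℝ) / 2 < s.re) :
    mellin (thetaSeries 0 a b z) s =
      2 * (Real.pi : ℂ) ^ (-s) * Gamma s * (z.im : ℂ) ^ b * eisensteinSeries (b - a) z (s - b) := by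
  have hz : 0 < (z : ℂ).im := z.2
  have hterm (p : NonzeroPair) := linForm_pow_mul_conj_pow_div a b hz p.2 s
  have hsum := hasSum_mellin_pi_mul (F := thetaSeries 0 a b z)
    (a := fun p : NonzeroPair => linForm p z ^ a * starRingEnd ℂ (linForm p z) ^ b)
    (q := fun p => ‖linForm p z‖ ^ 2 / (z : ℂ).im) (s := s)
    (fun p => .inr (div_pos (pow_pos (norm_linForm_pos hz p.2) 2) hz))
    (lt_trans (by positivity) hs) (fun t ht => ?_) (summable_norm_linForm_pow_div a b hz hs)
  · simp only [mul_div_assoc (_ * Gamma s), hterm] at hsum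
    rw [← hsum.tsum_eq, tsum_mul_left, tsum_mul_left, eisensteinSeries_eq_tsum]
    change _ * ((z.im : ℂ) ^ b * _) = _
    ring
  · convert! (summable_thetaTerm 0 a b hz ht).hasSum using 2 with p
    rw [thetaTerm, pow_zero, one_mul, ofReal_exp, mul_conj, normSq_eq_norm_sq]
    push_cast
    ring_nf

/-- The entire function of `s` which for `a = 0` or `b = 0` is the completed Eisenstein series
`π ^ (-(s + κ / 2)) Γ (s + κ / 2 + |κ| / 2) E_κ(z, s)` of weight `κ = b - a`. -/
def completedTheta (a b : ℕ) (z s : ℂ) : ℂ :=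
  (Real.pi : ℂ) ^ ((a + b) / 2) / 2 * ((z.im : ℂ)⁻¹) ^ b *
    (tailTheta 0 a b 0 (s + (b - 1)) z + tailTheta 0 a b 0 (a - s) z)

lemma differentiable_completedTheta (a b : ℕ) {z : ℂ} (hz : 0 < z.im) :
    Differentiable ℂ (completedTheta a b z) :=
  ((differentiable_tailTheta_add 0 a b 0 _ hz).add
    (differentiable_tailTheta_sub 0 a b 0 _ hz)).const_mul _

lemma IsEntireContinuation.eq {k : ℤ} {z : ℍ} {f g : ℂ → ℂ} (hf : IsEntireContinuation k z f)
    (hg : IsEntireContinuation k z g) : f = g := by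
  set c : ℂ := ((1 - (k : ℝ) / 2 + 1 : ℝ) : ℂ) with hc
  refine AnalyticOnNhd.eq_of_eventuallyEq (z₀ := c)
    (fun s _ => hf.1.analyticAt s) (fun s _ => hg.1.analyticAt s) ?_
  have hopen : IsOpen {s : ℂ | 1 - (k : ℝ) / 2 < s.re} :=
    isOpen_lt continuous_const Complex.continuous_re
  filter_upwards [hopen.mem_nhds (show c ∈ _ by simp [hc])] with s hs
  rw [hf.2 s hs, hg.2 s hs]

lemma IsEntireContinuation.doublyCompleted_eq {k : ℤ} {z : ℍ} {f : ℂ → ℂ}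
    (hf : IsEntireContinuation k z f) : doublyCompleted k z = f := by
  have h : ∃ f : ℂ → ℂ, IsEntireContinuation k z f := ⟨f, hf⟩
  rw [doublyCompleted, dif_pos h]
  exact h.choose_spec.eq hf

section continuation

variable {a b : ℕ} (hab : a = 0 ∨ b = 0) (heven : Even (a + b)) (hne : a + b ≠ 0) (z : ℍ)

include hab heven hne

lemma completedTheta_eq {s : ℂ} (hs : 1 - ((b : ℝ) - a) / 2 < s.re) :
    completedTheta a b z s = (Real.pi : ℂ) ^ (-(s + ((b : ℂ) - a) / 2)) * Gamma (s + b) *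
      eisensteinSeries (b - a) z s := by
  have hz : 0 < (z : ℂ).im := z.2
  have hpi : (Real.pi : ℂ) ≠ 0 := ofReal_ne_zero.2 Real.pi_ne_zero
  have hy : ((z : ℂ).im : ℂ) ≠ 0 := ofReal_ne_zero.2 hz.ne'
  have hmellin := mellin_thetaSeries a b z (s := s + b) (by
    rw [add_re, natCast_re]
    push_cast
    linarith)
  rw [mellin_eq_add_of_inv_eq (fun t ht => thetaSeries_inv hab heven hne hz ht)
    (fun s => integrableOn_cpow_mul_thetaSeries 0 a b s hz), ← tailTheta_zero_eq 0 a b _ hz,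
    ← tailTheta_zero_eq 0 a b _ hz, add_sub_assoc, add_sub_cancel_right,
    show ((a + b + 1 : ℕ) : ℂ) - (s + b) - 1 = a - s by push_cast; ring] at hmellin
  have hpow : (Real.pi : ℂ) ^ (-(s + ((b : ℂ) - a) / 2)) =
      Real.pi ^ ((a + b) / 2) * (Real.pi : ℂ) ^ (-(s + b)) := by
    rw [← cpow_natCast, ← cpow_add _ _ hpi, Nat.cast_div_charZero heven.two_dvd]
    push_cast
    ring_nf
  rw [completedTheta, hmellin, hpow, ← coe_im z, inv_pow]
  field_simp

theorem isEntireContinuation_completedTheta :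
    IsEntireContinuation (b - a) z fun s =>
      (s + ((b : ℂ) - a) / 2) * (s + ((b : ℂ) - a) / 2 - 1) * completedTheta a b z s := by
  refine ⟨?_, fun s hs => ?_⟩
  · have := differentiable_completedTheta a b (z := z) z.2
    fun_prop
  · have habs : |(b : ℤ) - a| = a + b := by
      rcases hab with rfl | rfl <;> simp
    have hgamma : s + ((b : ℂ) - a) / 2 + ((a : ℂ) + b) / 2 = s + b := by ring
    beta_reduce
    rw [completedTheta_eq hab heven hne z (by push_cast at hs; exact hs), doublyCompletedSeries,
      habs]
    push_cast
    rw [hgamma]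

end continuation

/-- The `n`-th Taylor coefficient of `f` at `0`. -/
def taylorAt (f : ℂ → ℂ) (n : ℕ) : ℂ := iteratedDeriv n f 0 / n.factorial

lemma taylorCoeff_eq_taylorAt (k : ℤ) (n : ℕ) (z : ℍ) :
    taylorCoeff k n z = taylorAt (doublyCompleted k z) n := rfl

/-- `c n` shifted by one, with value `0` at `0`: multiplication of a power series by its
variable. -/
def shift (c : ℕ → ℂ) : ℕ → ℂ
  | 0 => 0
  | n + 1 => c n

lemma map_shift (φ : ℂ →+* ℂ) (c : ℕ → ℂ) (n : ℕ) :
    φ (shift c n) = shift (fun n => φ (c n)) n := by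
  cases n <;> simp [shift]

lemma shift_const_mul (x : ℂ) (c : ℕ → ℂ) : (shift fun n => x * c n) = fun n => x * shift c n := by
  ext n
  cases n <;> simp [shift]

section taylorAt

variable {f g : ℂ → ℂ}

lemma taylorAt_add (hf : Differentiable ℂ f) (hg : Differentiable ℂ g) (n : ℕ) :
    taylorAt (fun s => f s + g s) n = taylorAt f n + taylorAt g n := by
  rw [taylorAt, iteratedDeriv_fun_add hf.contDiff.contDiffAt hg.contDiff.contDiffAt, add_div,
    taylorAt, taylorAt]

lemma taylorAt_const_mul (c : ℂ) (f : ℂ → ℂ) (n : ℕ) :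
    taylorAt (fun s => c * f s) n = c * taylorAt f n := by
  rw [taylorAt, iteratedDeriv_const_mul_field, mul_div_assoc, taylorAt]

lemma iteratedDeriv_id_mul_apply_zero (n : ℕ) (hf : Differentiable ℂ f) :
    iteratedDeriv n (fun s => s * f s) 0 = n * iteratedDeriv (n - 1) f 0 := by
  induction n generalizing f with
  | zero => simp
  | succ n ih =>
    have hf' : Differentiable ℂ (deriv f) := (hf.contDiff (n := 2)).differentiable_deriv_two
    have hsf' : Differentiable ℂ fun s => s * deriv f s := differentiable_id.mul hf'
    have hderiv : deriv (fun s => s * f s) = fun s => f s + s * deriv f s := by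
      ext s
      simp [hf s]
    rw [iteratedDeriv_succ', hderiv, iteratedDeriv_fun_add hf.contDiff.contDiffAt
      hsf'.contDiff.contDiffAt, ih hf']
    cases n with
    | zero => simp
    | succ n =>
      rw [Nat.add_sub_cancel, Nat.add_sub_cancel, ← iteratedDeriv_succ']
      push_cast
      ring

lemma taylorAt_id_mul (hf : Differentiable ℂ f) :
    taylorAt (fun s => s * f s) = shift (taylorAt f) := by
  ext n
  rw [taylorAt, iteratedDeriv_id_mul_apply_zero n hf]
  cases n with
  | zero => simp [shift]
  | succ n =>
    have hn : ((n + 1 : ℕ) : ℂ) ≠ 0 := Nat.cast_ne_zero.2 n.succ_ne_zero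
    rw [Nat.factorial_succ, Nat.cast_mul, mul_div_mul_left _ _ hn, Nat.add_sub_cancel, shift,
      taylorAt]

lemma taylorAt_quadratic_mul (hf : Differentiable ℂ f) (c₀ c₁ : ℂ) (n : ℕ) :
    taylorAt (fun s => (c₀ + c₁ * s + s * s) * f s) n =
      c₀ * taylorAt f n + c₁ * shift (taylorAt f) n + shift (shift (taylorAt f)) n := by
  have hsf : Differentiable ℂ fun s => s * f s := differentiable_id.mul hf
  have hssf : Differentiable ℂ fun s => s * (s * f s) := differentiable_id.mul hsf
  have hlin : Differentiable ℂ fun s => c₀ * f s + c₁ * (s * f s) :=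
    (hf.const_mul c₀).add (hsf.const_mul c₁)
  have hexpand : (fun s => (c₀ + c₁ * s + s * s) * f s) = fun s =>
      (c₀ * f s + c₁ * (s * f s)) + s * (s * f s) := by
    ext s
    ring
  rw [hexpand, taylorAt_add hlin hssf, taylorAt_add (hf.const_mul c₀) (hsf.const_mul c₁),
    taylorAt_const_mul, taylorAt_const_mul, taylorAt_id_mul hsf, taylorAt_id_mul hf]

end taylorAt

section derivFamily

variable {F : ℕ → ℂ → ℂ} (hF : ∀ n s, HasDerivAt (F n) (F (n + 1) s) s)

include hF

lemma iteratedDeriv_eq_of_hasDerivAt (n : ℕ) : iteratedDeriv n (F 0) = F n := by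
  induction n with
  | zero => exact iteratedDeriv_zero
  | succ n ih => rw [iteratedDeriv_succ, ih, funext fun s => (hF n s).deriv]

lemma taylorAt_comp_add_add_comp_sub (c d : ℂ) (n : ℕ) :
    taylorAt (fun s => F 0 (s + c) + F 0 (d - s)) n =
      (F n c + (-1) ^ n * F n d) / n.factorial := by
  have hdiff : Differentiable ℂ (F 0) := fun s => (hF 0 s).differentiableAt
  have hadd : Differentiable ℂ fun s => F 0 (s + c) :=
    hdiff.comp (differentiable_id.add_const c)
  have hsub : Differentiable ℂ fun s => F 0 (d - s) :=
    hdiff.comp (differentiable_id.const_sub d)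
  rw [taylorAt_add hadd hsub, taylorAt, taylorAt,
    iteratedDeriv_comp_add_const, iteratedDeriv_comp_const_sub, iteratedDeriv_eq_of_hasDerivAt hF]
  simp only [zero_add, sub_zero, smul_eq_mul]
  ring

end derivFamily

lemma thetaTerm_succ_succ (i a b : ℕ) (p : ℤ × ℤ) (z : ℂ) (t : ℝ) :
    thetaTerm i (a + 1) (b + 1) p z t =
      linForm p z * starRingEnd ℂ (linForm p z) * thetaTerm i a b p z t := by
  simp only [thetaTerm]
  ring

lemma hasDerivAt_thetaTerm (i a b : ℕ) (p : ℤ × ℤ) (z : ℂ) (t : ℝ) :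
    HasDerivAt (thetaTerm i a b p z)
      (-(Real.pi * (z.im : ℂ)⁻¹) * thetaTerm i (a + 1) (b + 1) p z t) t := by
  rw [thetaTerm_succ_succ]
  unfold thetaTerm
  have hexp := ((((hasDerivAt_id t).ofReal_comp).const_mul (Real.pi : ℂ)).fun_neg).mul_const
    (linForm p z * starRingEnd ℂ (linForm p z) * (z.im : ℂ)⁻¹)
  refine (hexp.cexp.const_mul _).congr_deriv ?_
  simp only [id, ofReal_one]
  ring

section partialIntegration

variable (i a b : ℕ) {z : ℂ} (hz : 0 < z.im)

include hz

lemma hasDerivAt_thetaSeries {t : ℝ} (ht : 0 < t) :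
    HasDerivAt (thetaSeries i a b z)
      (-(Real.pi * (z.im : ℂ)⁻¹) * thetaSeries i (a + 1) (b + 1) z t) t := by
  set N := i + (a + 1) + (b + 1) + 3
  obtain ⟨C, hC, hle⟩ := exists_norm_thetaTerm_le i (a + 1) (b + 1) N (by omega) |z.re| hz
  have hmem : t ∈ Set.Ioi (t / 2) := half_lt_self ht
  rw [thetaSeries, ← tsum_mul_left]
  refine hasDerivAt_tsum_of_isPreconnected
    (u := fun p : NonzeroPair => Real.pi * z.im⁻¹ * (C * (z.im / (t / 2)) ^ N) * (‖p.1‖ ^ 3)⁻¹)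
    (summable_norm_prod_int_cube_inv.mul_left _) isOpen_Ioi isPreconnected_Ioi
    (fun p r _ => hasDerivAt_thetaTerm i a b p z r) (fun p r hr => ?_)
    hmem (summable_thetaTerm i a b hz ht) hmem
  have hr0 : 0 < r := (half_pos ht).trans hr
  rw [norm_mul, norm_neg, norm_mul, norm_inv, norm_real, norm_real,
    Real.norm_of_nonneg Real.pi_pos.le, Real.norm_of_nonneg hz.le, mul_assoc (Real.pi * z.im⁻¹)]
  gcongr
  refine (hle z le_rfl le_rfl p.1 p.2 r hr0).trans ?_
  gcongr
  exact le_of_lt hr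

lemma pi_div_im_mul_tailTheta_succ_succ (s : ℂ) :
    Real.pi * (z.im : ℂ)⁻¹ * tailTheta i (a + 1) (b + 1) 0 s z =
      thetaSeries i a b z 1 + s * tailTheta i a b 0 (s - 1) z := by
  have hθ := integrableOn_cpow_mul_thetaSeries i a b (z := z)
  have hθ' := integrableOn_cpow_mul_thetaSeries i (a + 1) (b + 1) s hz
  have hderiv : ∀ t ∈ Set.Ici (1 : ℝ), HasDerivAt (fun t : ℝ => (t : ℂ) ^ s * thetaSeries i a b z t)
      (s * ((t : ℂ) ^ (s - 1) * thetaSeries i a b z t) +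
        -(Real.pi * (z.im : ℂ)⁻¹) * ((t : ℂ) ^ s * thetaSeries i (a + 1) (b + 1) z t)) t := by
    intro t ht
    have ht0 : 0 < t := one_pos.trans_le ht
    have hcpow := ((hasDerivAt_id (t : ℂ)).cpow_const (c := s) (Or.inl ht0)).comp_ofReal
    refine (hcpow.mul (hasDerivAt_thetaSeries i a b hz ht0)).congr_deriv ?_
    simp only [id]
    ring
  have hint := ((hθ (s - 1) hz).const_mul s).add (hθ'.const_mul (-(Real.pi * (z.im : ℂ)⁻¹)))
  have hlim := tendsto_zero_of_hasDerivAt_of_integrableOn_Ioi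
    (fun t ht => hderiv t (Set.Ioi_subset_Ici_self ht)) hint (hθ s hz)
  have hparts := integral_Ioi_of_hasDerivAt_of_tendsto' hderiv hint hlim
  rw [integral_add ((hθ (s - 1) hz).const_mul s) (hθ'.const_mul _), integral_const_mul,
    integral_const_mul, ← tailTheta_zero_eq i a b _ hz, ← tailTheta_zero_eq i _ _ _ hz, ofReal_one,
    one_cpow] at hparts
  linear_combination -hparts

end partialIntegration

-- Differentiate the functional equation `θ (1 / t) = t ^ (a + 1) θ t` at its fixed point `t = 1`.
lemma add_one_mul_thetaSeries_one {a : ℕ} (ha : Even a) (ha0 : a ≠ 0) {z : ℂ} (hz : 0 < z.im) :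
    (a + 1) * thetaSeries 0 0 a z 1 =
      2 * (Real.pi * (z.im : ℂ)⁻¹ * thetaSeries 0 1 (a + 1) z 1) := by
  have hd := hasDerivAt_thetaSeries 0 0 a hz one_pos
  set D := -(Real.pi * (z.im : ℂ)⁻¹) * thetaSeries 0 (0 + 1) (a + 1) z 1 with hD
  have hleft : HasDerivAt (fun t : ℝ => thetaSeries 0 0 a z t⁻¹) (-D) 1 := by
    have hd' : HasDerivAt (thetaSeries 0 0 a z) D (1 : ℝ)⁻¹ := by rwa [inv_one]
    simpa using! hd'.scomp (1 : ℝ) (hasDerivAt_inv one_ne_zero)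
  have hright : HasDerivAt (fun t : ℝ => (t : ℂ) ^ (a + 1) * thetaSeries 0 0 a z t)
      ((a + 1) * thetaSeries 0 0 a z 1 + D) 1 := by
    refine ((((hasDerivAt_id (1 : ℝ)).ofReal_comp).fun_pow (a + 1)).mul hd).congr_deriv ?_
    simp
  have hinv : (fun t : ℝ => thetaSeries 0 0 a z t⁻¹) =ᶠ[𝓝 1]
      fun t : ℝ => (t : ℂ) ^ (a + 1) * thetaSeries 0 0 a z t := by
    filter_upwards [Ioi_mem_nhds one_pos] with t ht
    simpa using thetaSeries_inv (.inl rfl) (by rwa [zero_add]) (by rwa [zero_add]) hz ht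
  have heq := hleft.unique (hright.congr_of_eventuallyEq hinv)
  rw [hD, zero_add] at heq
  linear_combination -heq

/-- Up to the factor `-(i / 2) y ^ (-(a + 3))`, the `∂/∂z̄`-derivative of
`y ^ (-(a + 2)) * tailTheta 0 0 (a + 2) n s`. -/
def tailThetaBar (a n : ℕ) (s z : ℂ) : ℂ :=
  (a + 2) * tailTheta 0 1 (a + 1) n s z -
    Real.pi * (z.im : ℂ)⁻¹ * tailTheta 0 2 (a + 2) n (s + 1) z

lemma hasDerivAt_tailThetaBar (a n : ℕ) (s : ℂ) {z : ℂ} (hz : 0 < z.im) :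
    HasDerivAt (fun s => tailThetaBar a n s z) (tailThetaBar a (n + 1) s z) s :=
  ((hasDerivAt_tailTheta 0 1 (a + 1) n s hz).const_mul _).sub
    (((hasDerivAt_tailTheta 0 2 (a + 2) n (s + 1) hz).comp_add_const s 1).const_mul _)

lemma pi_div_im_mul_tailThetaBar_zero (a : ℕ) (s : ℂ) {z : ℂ} (hz : 0 < z.im) :
    Real.pi * (z.im : ℂ)⁻¹ * tailThetaBar a 0 s z =
      (a + 1 - s) * (thetaSeries 0 0 a z 1 + s * tailTheta 0 0 a 0 (s - 1) z) -
        Real.pi * (z.im : ℂ)⁻¹ * thetaSeries 0 1 (a + 1) z 1 := by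
  have hparts₀ := pi_div_im_mul_tailTheta_succ_succ 0 0 a hz s
  have hparts₁ := pi_div_im_mul_tailTheta_succ_succ 0 1 (a + 1) hz (s + 1)
  rw [add_sub_cancel_right] at hparts₁
  rw [zero_add] at hparts₀
  rw [tailThetaBar]
  linear_combination (a + 1 - s) * hparts₀ - Real.pi * (z.im : ℂ)⁻¹ * hparts₁

lemma pi_mul_tailThetaBar_add_tailThetaBar {a : ℕ} (ha : Even a) (ha0 : a ≠ 0) {z : ℂ}
    (hz : 0 < z.im) (s : ℂ) :
    Real.pi * (tailThetaBar a 0 (s + (a + 1)) z + tailThetaBar a 0 (0 - s) z) =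
      -(z.im : ℂ) * ((0 + (a + 1) * s + s * s) *
        (tailTheta 0 0 a 0 (s + a) z + tailTheta 0 0 a 0 (-1 - s) z)) := by
  have hy : (z.im : ℂ) ≠ 0 := ofReal_ne_zero.2 hz.ne'
  have h₁ := pi_div_im_mul_tailThetaBar_zero a (s + (a + 1)) hz
  have h₂ := pi_div_im_mul_tailThetaBar_zero a (0 - s) hz
  rw [show s + ((a : ℂ) + 1) - 1 = s + a by ring] at h₁
  rw [show 0 - s - 1 = -1 - s by ring] at h₂
  refine mul_left_cancel₀ (inv_ne_zero hy) ?_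
  rw [mul_left_comm _ (-(z.im : ℂ)), ← mul_assoc (-(z.im : ℂ)), neg_mul, mul_inv_cancel₀ hy]
  linear_combination h₁ + h₂ + add_one_mul_thetaSeries_one ha ha0 hz

/-- The Taylor coefficients at `s = 0` of
`tailTheta 0 0 a 0 (s + a) z + tailTheta 0 0 a 0 (-1 - s) z`. -/
def symmTailTheta (a n : ℕ) (z : ℂ) : ℂ :=
  (tailTheta 0 0 a n a z + (-1) ^ n * tailTheta 0 0 a n (-1) z) / n.factorial

lemma pi_mul_tailThetaBar_taylor {a : ℕ} (ha : Even a) (ha0 : a ≠ 0) (n : ℕ) {z : ℂ}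
    (hz : 0 < z.im) :
    Real.pi * ((tailThetaBar a n (a + 1) z + (-1) ^ n * tailThetaBar a n 0 z) / n.factorial) =
      -(z.im : ℂ) * ((a + 1) * shift (symmTailTheta a · z) n +
        shift (shift (symmTailTheta a · z)) n) := by
  have hsum : Differentiable ℂ fun s =>
      tailTheta 0 0 a 0 (s + a) z + tailTheta 0 0 a 0 (-1 - s) z :=
    (differentiable_tailTheta_add 0 0 a 0 _ hz).add (differentiable_tailTheta_sub 0 0 a 0 _ hz)
  have hcoeff : (taylorAt fun s => tailTheta 0 0 a 0 (s + a) z + tailTheta 0 0 a 0 (-1 - s) z) =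
      (symmTailTheta a · z) :=
    funext <| taylorAt_comp_add_add_comp_sub
      (F := fun n s => tailTheta 0 0 a n s z) (fun n s => hasDerivAt_tailTheta 0 0 a n s hz) _ _
  rw [← taylorAt_comp_add_add_comp_sub (F := fun n s => tailThetaBar a n s z)
    (fun n s => hasDerivAt_tailThetaBar a n s hz), ← taylorAt_const_mul,
    funext (pi_mul_tailThetaBar_add_tailThetaBar ha ha0 hz), taylorAt_const_mul,
    taylorAt_quadratic_mul hsum, hcoeff, zero_mul, zero_add]

/-- The `n`-th Taylor coefficient at `s = 0` of `completedTheta a b z s`. -/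
def completedCoeff (a b n : ℕ) (z : ℂ) : ℂ :=
  (Real.pi : ℂ) ^ ((a + b) / 2) / 2 / n.factorial * (((z.im : ℂ)⁻¹) ^ b *
    (tailTheta 0 a b n (b - 1) z + (-1) ^ n * tailTheta 0 a b n a z))

lemma taylorAt_completedTheta (a b n : ℕ) {z : ℂ} (hz : 0 < z.im) :
    taylorAt (completedTheta a b z) n = completedCoeff a b n z := by
  unfold completedTheta
  rw [taylorAt_const_mul, taylorAt_comp_add_add_comp_sub (F := fun n s => tailTheta 0 a b n s z)
    (fun n s => hasDerivAt_tailTheta 0 a b n s hz), completedCoeff]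
  ring

lemma contDiffOn_im_inv_pow (b : ℕ) :
    ContDiffOn ℝ ∞ (fun z : ℂ => ((z.im : ℂ)⁻¹) ^ b) upperHalfPlaneSet :=
  ((ofRealCLM.comp imCLM).contDiff.contDiffOn.inv fun _ hz => ofReal_ne_zero.2 (ne_of_gt hz)).pow b

lemma contDiffOn_completedCoeff (a b n : ℕ) :
    ContDiffOn ℝ ∞ (completedCoeff a b n) upperHalfPlaneSet :=
  contDiffOn_const.mul ((contDiffOn_im_inv_pow b).mul ((contDiffOn_tailTheta _ _ _ _ _).add
    (contDiffOn_const.mul (contDiffOn_tailTheta _ _ _ _ _))))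

lemma xi_completedCoeff_neg (a n : ℕ) (z : ℍ) :
    xi (-(a : ℤ)) (fun z : ℍ => completedCoeff a 0 n z) z =
      (-1) ^ n * completedCoeff 0 (a + 2) n z := by
  have hz : 0 < (z : ℂ).im := z.2
  have hderiv := ((hasWirtingerDerivAt_tailTheta 0 a 0 n (-1) hz).add
    ((hasWirtingerDerivAt_tailTheta 0 a 0 n a hz).const_mul ((-1) ^ n))).const_mul
    ((Real.pi : ℂ) ^ (a / 2) / 2 / n.factorial)
  have hsq : ((-1 : ℂ)) ^ n * (-1) ^ n = 1 := by rw [← mul_pow]; simp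
  rw [xi_eq, hderiv.partialZBar_eq fun w => by simp [completedCoeff]]
  simp only [completedCoeff, map_mul, map_add, map_div₀, map_pow, map_neg, map_one, conj_tailTheta,
    map_inv₀, conj_ofReal, conj_I, map_natCast, map_ofNat, Nat.cast_zero, zero_mul, zero_add,
    Nat.add_div_right _ two_pos, map_zero, zpow_neg, zpow_natCast, neg_add_cancel]
  rw [show ((a + 2 : ℕ) : ℂ) - 1 = a + 1 by push_cast; ring]
  linear_combination (-((Real.pi : ℂ) ^ (a / 2) * Real.pi / 2 / n.factorial *
      ((z : ℂ).im : ℂ)⁻¹ ^ (a + 2))) * (tailTheta 0 0 (a + 2) n 0 z +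
    (-1) ^ n * tailTheta 0 0 (a + 2) n (a + 1) z) * I_mul_I -
    (Real.pi : ℂ) ^ (a / 2) * Real.pi / 2 / n.factorial * ((z : ℂ).im : ℂ)⁻¹ ^ (a + 2) *
      tailTheta 0 0 (a + 2) n 0 z * hsq

lemma tailTheta_one_eq (b n : ℕ) (s : ℂ) {z : ℂ} (hz : 0 < z.im) :
    tailTheta 1 0 b n s z =
      -(Complex.I / 2) * (z.im : ℂ)⁻¹ * (tailTheta 0 1 b n s z - tailTheta 0 0 (b + 1) n s z) := by
  have hint (a b : ℕ) := integrable_thetaIntegrand ae_tailMeasure_pos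
    (admissible_cpowMulLogPow s n) 0 a b hz
  have hy : (z.im : ℂ) ≠ 0 := ofReal_ne_zero.2 hz.ne'
  simp only [tailTheta, thetaIntegral]
  rw [← integral_sub (hint 1 b) (hint 0 (b + 1)), ← integral_const_mul]
  refine integral_congr_ae (.of_forall fun x => ?_)
  have hm : (x.2.1.1 : ℂ) = -(Complex.I / 2) * (z.im : ℂ)⁻¹ *
      (linForm x.2 z - starRingEnd ℂ (linForm x.2 z)) := by
    rw [linForm_sub_conj]
    field_simp
    linear_combination (x.2.1.1 : ℂ) * I_sq
  simp only [thetaIntegrand, thetaTerm, pow_one, pow_zero, one_mul, mul_one]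
  rw [hm]
  ring

lemma hasWirtingerDerivAt_im_inv_pow_mul_tailTheta (a n : ℕ) (s : ℂ) {z : ℂ} (hz : 0 < z.im) :
    ∃ A, HasWirtingerDerivAt (fun w => ((w.im : ℂ)⁻¹) ^ (a + 2) * tailTheta 0 0 (a + 2) n s w) A
      (-(Complex.I / 2) * ((z.im : ℂ)⁻¹) ^ (a + 3) * tailThetaBar a n s z) z := by
  have hy : (z.im : ℂ) ≠ 0 := ofReal_ne_zero.2 hz.ne'
  have hpow : HasDerivAt (fun u : ℂ => u⁻¹ ^ (a + 2)) _ (z.im : ℂ) :=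
    (hasDerivAt_inv hy).fun_pow (a + 2)
  refine ⟨_, ((HasWirtingerDerivAt.im.comp_of_hasDerivAt hpow).mul
    (hasWirtingerDerivAt_tailTheta 0 0 (a + 2) n s hz)).congr_deriv rfl ?_⟩
  rw [show a + 2 - 1 = a + 1 by omega, tailTheta_one_eq (a + 1) n s hz, tailThetaBar]
  push_cast
  ring

lemma neg_one_pow_mul_completedCoeff_neg (a n : ℕ) (z : ℂ) :
    (-1) ^ n * completedCoeff a 0 n z =
      (Real.pi : ℂ) ^ (a / 2) / 2 * starRingEnd ℂ (symmTailTheta a n z) := by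
  have hsq : ((-1 : ℂ)) ^ n * (-1) ^ n = 1 := by rw [← mul_pow]; simp
  simp only [symmTailTheta, completedCoeff, map_div₀, map_add, map_mul, map_pow, map_neg, map_one,
    conj_tailTheta, map_natCast, Nat.cast_zero, zero_sub, pow_zero, one_mul, add_zero]
  linear_combination (Real.pi : ℂ) ^ (a / 2) / 2 / n.factorial * tailTheta 0 a 0 n a z * hsq

lemma partialZBar_completedCoeff_pos {a : ℕ} (ha : Even a) (ha0 : a ≠ 0) (n : ℕ) (z : ℍ) :
    partialZBar (fun z : ℍ => completedCoeff 0 (a + 2) n z) z =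
      Complex.I / 2 * ((Real.pi : ℂ) ^ (a / 2) / 2) * ((z : ℂ).im : ℂ)⁻¹ ^ (a + 2) *
        ((a + 1) * shift (symmTailTheta a · z) n + shift (shift (symmTailTheta a · z)) n) := by
  have hz : 0 < (z : ℂ).im := z.2
  have hy : ((z : ℂ).im : ℂ) ≠ 0 := ofReal_ne_zero.2 hz.ne'
  obtain ⟨_, h₁⟩ := hasWirtingerDerivAt_im_inv_pow_mul_tailTheta a n (a + 1) hz
  obtain ⟨_, h₂⟩ := hasWirtingerDerivAt_im_inv_pow_mul_tailTheta a n 0 hz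
  rw [((h₁.add (h₂.const_mul ((-1) ^ n))).const_mul
    ((Real.pi : ℂ) ^ (a / 2 + 1) / 2 / n.factorial)).partialZBar_eq fun w => ?_]
  · have htaylor := pi_mul_tailThetaBar_taylor ha ha0 n hz
    have hinv := inv_mul_cancel₀ hy
    generalize shift (symmTailTheta a · z) n = c₁ at htaylor ⊢
    generalize shift (shift (symmTailTheta a · z)) n = c₂ at htaylor ⊢
    linear_combination -(Complex.I / 2) * ((Real.pi : ℂ) ^ (a / 2) / 2) *
      ((z : ℂ).im : ℂ)⁻¹ ^ (a + 3) * htaylor + Complex.I / 2 * ((Real.pi : ℂ) ^ (a / 2) / 2) *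
      ((z : ℂ).im : ℂ)⁻¹ ^ (a + 2) * ((a + 1) * c₁ + c₂) * hinv
  · rw [completedCoeff, zero_add, Nat.add_div_right _ two_pos, Nat.cast_zero,
      show ((a + 2 : ℕ) : ℂ) - 1 = a + 1 by push_cast; ring]
    ring

lemma xi_completedCoeff_pos {a : ℕ} (ha : Even a) (ha0 : a ≠ 0) (n : ℕ) (z : ℍ) :
    xi ((a + 2 : ℕ) : ℤ) (fun z : ℍ => completedCoeff 0 (a + 2) n z) z =
      (a + 1) * shift (fun n => (-1) ^ n * completedCoeff a 0 n z) n +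
        shift (shift fun n => (-1) ^ n * completedCoeff a 0 n z) n := by
  have hy : ((z : ℂ).im : ℂ) ≠ 0 := ofReal_ne_zero.2 z.im_ne_zero
  have hpow : ((z : ℂ).im : ℂ) ^ (a + 2) * ((z : ℂ).im : ℂ)⁻¹ ^ (a + 2) = 1 := by
    rw [← mul_pow, mul_inv_cancel₀ hy, one_pow]
  rw [xi_eq, partialZBar_completedCoeff_pos ha ha0]
  simp only [neg_one_pow_mul_completedCoeff_neg, shift_const_mul, map_mul, map_add, map_div₀,
    map_pow, conj_ofReal, conj_I, map_natCast, map_ofNat, map_inv₀, map_one, map_shift,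
    zpow_natCast]
  generalize shift (fun n => starRingEnd ℂ (symmTailTheta a n z)) n = c₁
  generalize shift (shift fun n => starRingEnd ℂ (symmTailTheta a n z)) n = c₂
  linear_combination (-Complex.I * Complex.I * ((Real.pi : ℂ) ^ (a / 2) / 2) *
    ((a + 1) * c₁ + c₂)) * hpow - ((Real.pi : ℂ) ^ (a / 2) / 2) * ((a + 1) * c₁ + c₂) * I_mul_I

/-- The action of `SL(2, ℤ)` on nonzero integral row vectors by right multiplication. -/
def vecMulEquiv (γ : SL(2, ℤ)) : NonzeroPair ≃ NonzeroPair :=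
  have hdet : γ 0 0 * γ 1 1 - γ 0 1 * γ 1 0 = 1 := by rw [← Matrix.det_fin_two, γ.det_coe]
  let e : ℤ × ℤ ≃ ℤ × ℤ :=
    { toFun := fun p => (p.1 * γ 0 0 + p.2 * γ 1 0, p.1 * γ 0 1 + p.2 * γ 1 1)
      invFun := fun p => (p.1 * γ 1 1 - p.2 * γ 1 0, -p.1 * γ 0 1 + p.2 * γ 0 0)
      left_inv := fun p => by
        ext
        · linear_combination p.1 * hdet
        · linear_combination p.2 * hdet
      right_inv := fun p => by
        ext
        · linear_combination p.1 * hdet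
        · linear_combination p.2 * hdet }
  e.subtypeEquiv fun p => not_congr <| by
    rw [← e.apply_eq_iff_eq]
    simp [e]

section modularity

variable (γ : SL(2, ℤ)) (z : ℍ)

lemma denom_mul_conj_mul_im_smul :
    denom γ z * starRingEnd ℂ (denom γ z) * (((γ • z : ℍ) : ℂ).im : ℂ) = (z : ℂ).im := by
  rw [coe_im, coe_im, ModularGroup.im_smul_eq_div_normSq, mul_conj, ← ofReal_mul,
    mul_div_cancel₀ _ (normSq_eq_zero.not.2 (denom_ne_zero γ z))]

lemma denom_mul_linForm_smul (p : NonzeroPair) :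
    denom γ z * linForm p (γ • z : ℍ) = linForm (vecMulEquiv γ p) z := by
  have hden := denom_ne_zero γ z
  rw [linForm, coe_specialLinearGroup_apply]
  simp only [algebraMap_int_eq, Int.coe_castRingHom, ofReal_intCast, ← ModularGroup.denom_apply]
  field_simp
  simp only [ModularGroup.denom_apply, vecMulEquiv, linForm, Equiv.subtypeEquiv_apply,
    Equiv.coe_fn_mk]
  push_cast
  ring

lemma denom_pow_mul_thetaTerm_smul (a b : ℕ) (p : NonzeroPair) (t : ℝ) :
    denom γ z ^ a * starRingEnd ℂ (denom γ z) ^ b * thetaTerm 0 a b p (γ • z : ℍ) t =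
      thetaTerm 0 a b (vecMulEquiv γ p) z t := by
  have hden := denom_ne_zero γ z
  have hden' : starRingEnd ℂ (denom γ z) ≠ 0 := by simp
  have hy : (((γ • z : ℍ) : ℂ).im : ℂ) ≠ 0 := ofReal_ne_zero.2 (γ • z : ℍ).im_ne_zero
  have hexponent : linForm (vecMulEquiv γ p) z * starRingEnd ℂ (linForm (vecMulEquiv γ p) z) *
      ((z : ℂ).im : ℂ)⁻¹ = linForm p (γ • z : ℍ) * starRingEnd ℂ (linForm p (γ • z : ℍ)) *
        (((γ • z : ℍ) : ℂ).im : ℂ)⁻¹ := by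
    rw [← denom_mul_conj_mul_im_smul γ z, ← denom_mul_linForm_smul, map_mul]
    field_simp
  rw [thetaTerm, thetaTerm, hexponent, ← denom_mul_linForm_smul, map_mul]
  ring

lemma denom_pow_mul_tailTheta_smul (a b n : ℕ) (s : ℂ) :
    denom γ z ^ a * starRingEnd ℂ (denom γ z) ^ b * tailTheta 0 a b n s (γ • z : ℍ) =
      tailTheta 0 a b n s z := by
  rw [tailTheta, tailTheta, thetaIntegral_eq_integral_thetaSeries ae_tailMeasure_pos
      (admissible_cpowMulLogPow s n) 0 a b (γ • z : ℍ).im_pos,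
    thetaIntegral_eq_integral_thetaSeries ae_tailMeasure_pos (admissible_cpowMulLogPow s n) 0 a b
      z.im_pos, ← integral_const_mul]
  refine integral_congr_ae (ae_of_all _ fun t => ?_)
  beta_reduce
  rw [mul_left_comm, thetaSeries, ← tsum_mul_left]
  simp only [denom_pow_mul_thetaTerm_smul]
  rw [(vecMulEquiv γ).tsum_eq fun p : NonzeroPair => thetaTerm 0 a b p z t, thetaSeries]

lemma completedCoeff_smul (a b n : ℕ) :
    completedCoeff a b n (γ • z : ℍ) = denom γ z ^ ((b : ℤ) - a) * completedCoeff a b n z := by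
  have hden := denom_ne_zero γ z
  have hden' : starRingEnd ℂ (denom γ z) ≠ 0 := by simp
  have hy : (((γ • z : ℍ) : ℂ).im : ℂ) ≠ 0 := ofReal_ne_zero.2 (γ • z : ℍ).im_ne_zero
  rw [completedCoeff, completedCoeff, ← denom_pow_mul_tailTheta_smul γ z a b n (b - 1),
    ← denom_pow_mul_tailTheta_smul γ z a b n a, zpow_sub₀ hden, zpow_natCast, zpow_natCast,
    ← denom_mul_conj_mul_im_smul γ z]
  simp only [inv_pow, mul_pow]
  field_simp

lemma completedCoeff_slash (a b n : ℕ) :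
    (fun z : ℍ => completedCoeff a b n z) ∣[(b : ℤ) - a] γ =
      fun z : ℍ => completedCoeff a b n z := by
  ext z
  rw [ModularForm.slash_action_eq'_iff, completedCoeff_smul, ModularGroup.denom_apply]

end modularity

/-- Functions that are `O(y ^ α)` at the cusp for some `α`, uniformly in `x`. -/
def moderateGrowth : Submodule ℂ (ℍ → ℂ) where
  carrier := {f | ∃ α : ℝ, f =O[atImInfty] fun z : ℍ => z.im ^ α}
  zero_mem' := ⟨0, Asymptotics.isBigO_zero _ _⟩
  add_mem' := by
    rintro f g ⟨α, hα⟩ ⟨β, hβ⟩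
    have rpow_isBigO {α γ : ℝ} (h : α ≤ γ) :
        (fun z : ℍ => z.im ^ α) =O[atImInfty] fun z : ℍ => z.im ^ γ := by
      refine Asymptotics.IsBigO.of_bound 1 ?_
      filter_upwards [(atImInfty_mem _).2 ⟨1, fun z hz => hz⟩] with z (hz : 1 ≤ z.im)
      rw [one_mul, Real.norm_of_nonneg (by positivity), Real.norm_of_nonneg (by positivity)]
      exact Real.rpow_le_rpow_of_exponent_le hz h
    exact ⟨max α β, (hα.trans (rpow_isBigO (le_max_left _ _))).add
      (hβ.trans (rpow_isBigO (le_max_right _ _)))⟩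
  smul_mem' := fun c _ ⟨α, hα⟩ => ⟨α, hα.const_smul_left c⟩

lemma mem_moderateGrowth_of_periodic {f : ℍ → ℂ}
    (hf : ∀ (n : ℤ) (z : ℍ), f (ModularGroup.T ^ n • z) = f z) {N : ℕ} {C : ℝ}
    (h : ∀ z : ℍ, |z.re| ≤ 1 → 1 ≤ z.im → ‖f z‖ ≤ C * z.im ^ N) : f ∈ moderateGrowth := by
  refine ⟨N, Asymptotics.IsBigO.of_bound C ?_⟩
  filter_upwards [(atImInfty_mem _).2 ⟨1, fun z hz => hz⟩] with z (hz : 1 ≤ z.im)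
  have hre : |(ModularGroup.T ^ (-round z.re) • z).re| ≤ 1 := by
    rw [ModularGroup.re_T_zpow_smul, Int.cast_neg, ← sub_eq_add_neg]
    exact (abs_sub_round _).trans (by norm_num)
  have him := ModularGroup.im_T_zpow_smul z (-round z.re)
  have hbound := h _ hre (him ▸ hz)
  rw [hf, him] at hbound
  rwa [Real.norm_of_nonneg (by positivity), Real.rpow_natCast]

lemma tailTheta_mem_moderateGrowth (a b n : ℕ) (s : ℂ) :
    (fun z : ℍ => tailTheta 0 a b n s z) ∈ moderateGrowth := by
  obtain ⟨N, C, hle⟩ := exists_norm_tailTheta_le 0 a b n s 1 one_pos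
  refine mem_moderateGrowth_of_periodic (fun m z => ?_) fun z hre him => hle z hre him
  rw [← denom_pow_mul_tailTheta_smul (ModularGroup.T ^ m) z a b n s, ModularGroup.denom_apply]
  simp [ModularGroup.coe_T_zpow]

lemma im_inv_pow_mul_mem_moderateGrowth {f : ℍ → ℂ} (hf : f ∈ moderateGrowth) (b : ℕ) :
    (fun z : ℍ => ((z : ℂ).im : ℂ)⁻¹ ^ b * f z) ∈ moderateGrowth := by
  obtain ⟨α, hα⟩ := hf
  refine ⟨α, (Asymptotics.IsBigO.of_bound 1 ?_).trans hα⟩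
  filter_upwards [(atImInfty_mem _).2 ⟨1, fun z hz => hz⟩] with z (hz : 1 ≤ z.im)
  rw [norm_mul, norm_pow, norm_inv, norm_real, coe_im, Real.norm_of_nonneg z.im_pos.le]
  gcongr
  exact pow_le_one₀ (by positivity) (inv_le_one_of_one_le₀ hz)

/-- Smooth functions that are modular of weight `k` and of moderate growth at the cusp. -/
def moderateForms (k : ℤ) : Submodule ℂ (ℍ → ℂ) where
  carrier := {f | f ∈ smoothFunctions ∧ (∀ γ : SL(2, ℤ), f ∣[k] γ = f) ∧ f ∈ moderateGrowth}
  zero_mem' := ⟨zero_mem _, fun γ => SlashAction.zero_slash k γ, zero_mem _⟩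
  add_mem' := fun ⟨hf, hf', hf''⟩ ⟨hg, hg', hg''⟩ =>
    ⟨add_mem hf hg, fun γ => by rw [SlashAction.add_slash, hf', hg'], add_mem hf'' hg''⟩
  smul_mem' := fun c _ ⟨hf, hf', hf''⟩ =>
    ⟨Submodule.smul_mem _ c hf, fun γ => by rw [ModularForm.SL_smul_slash, hf'],
      Submodule.smul_mem _ c hf''⟩

lemma moderateForms_le_smoothFunctions (k : ℤ) : moderateForms k ≤ smoothFunctions :=
  fun _ hf => hf.1

lemma completedCoeff_mem_moderateForms (a b n : ℕ) :
    (fun z : ℍ => completedCoeff a b n z) ∈ moderateForms ((b : ℤ) - a) := by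
  refine ⟨mem_smoothFunctions_of_contDiffOn (contDiffOn_completedCoeff a b n),
    fun γ => completedCoeff_slash γ a b n, ?_⟩
  exact Submodule.smul_mem _ ((Real.pi : ℂ) ^ ((a + b) / 2) / 2 / n.factorial)
    (im_inv_pow_mul_mem_moderateGrowth (add_mem (tailTheta_mem_moderateGrowth a b n (b - 1))
      (Submodule.smul_mem _ ((-1) ^ n) (tailTheta_mem_moderateGrowth a b n a))) b)

section rangeSums

variable {M : Type*} [AddCommGroup M] [Module ℂ M] {X : ℕ → M} {f : M}

lemma exists_linearCombination_eq_sum_range (c : ℕ →₀ ℂ) :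
    ∃ N, c.support ⊆ Finset.range N ∧
      Finsupp.linearCombination ℂ X c = ∑ n ∈ Finset.range N, c n • X n := by
  obtain ⟨N, hN⟩ := c.support.exists_nat_subset_range
  exact ⟨N, hN, Finsupp.sum_of_support_subset c hN _ fun n _ => zero_smul ℂ (X n)⟩

lemma exists_sum_range_of_mem_span (hf : f ∈ Submodule.span ℂ (Set.range X)) :
    ∃ (N : ℕ) (c : ℕ → ℂ), f = ∑ n ∈ Finset.range N, c n • X n := by
  obtain ⟨c, rfl⟩ := (Finsupp.mem_span_range_iff_exists_finsupp ..).1 hf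
  obtain ⟨N, -, hN⟩ := exists_linearCombination_eq_sum_range (X := X) c
  exact ⟨N, c, hN⟩

lemma exists_sum_range_of_mem_span_fin {m : ℕ}
    (hf : f ∈ Submodule.span ℂ (Set.range fun j : Fin m => X j)) :
    ∃ c : ℕ → ℂ, f = ∑ n ∈ Finset.range m, c n • X n := by
  obtain ⟨c, rfl⟩ := (Submodule.mem_span_range_iff_exists_fun ℂ).1 hf
  refine ⟨Function.extend Fin.val c 0, ?_⟩
  rw [← Fin.sum_univ_eq_sum_range fun n => Function.extend Fin.val c 0 n • X n]
  simp only [Fin.val_injective.extend_apply]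

lemma span_range_eq_of_triangular {Y : ℕ → M} {d : ℕ → ℕ → ℂ} (hd : ∀ n, d n 0 ≠ 0)
    (h : ∀ n, X n = ∑ l ∈ Finset.range (n + 1), d n l • Y (n - l)) :
    Submodule.span ℂ (Set.range X) = Submodule.span ℂ (Set.range Y) := by
  refine le_antisymm (Submodule.span_le.2 ?_) (Submodule.span_le.2 ?_)
  · rintro _ ⟨n, rfl⟩
    rw [h]
    exact sum_mem fun l _ => Submodule.smul_mem _ _ (Submodule.subset_span ⟨_, rfl⟩)
  · rintro _ ⟨n, rfl⟩
    induction n using Nat.strong_induction_on with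
    | _ n ih =>
      have hsolve : Y n = (d n 0)⁻¹ •
          (X n - ∑ l ∈ Finset.range n, d n (l + 1) • Y (n - (l + 1))) := by
        rw [h n, Finset.sum_range_succ', Nat.sub_zero, add_sub_cancel_left, inv_smul_smul₀ (hd n)]
      rw [hsolve]
      refine Submodule.smul_mem _ _ (sub_mem (Submodule.subset_span ⟨n, rfl⟩)
        (sum_mem fun l hl => Submodule.smul_mem _ _ (ih _ ?_)))
      have := Finset.mem_range.1 hl
      omega

end rangeSums

section tower

variable {k : ℤ} {κ : ℂ} {X : ℕ → ℍ → ℂ} (hκ : κ ≠ 0) (hX : ∀ n, X n ∈ smoothFunctions)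
  (hΔ : ∀ n, laplacian k (X n) = κ • prev X n) (hX0 : X 0 ≠ 0)

include hX hΔ in
lemma laplacian_sum_range (N : ℕ) (c : ℕ → ℂ) :
    laplacian k (∑ n ∈ Finset.range N, c n • X n) =
      ∑ n ∈ Finset.range (N - 1), (κ * c (n + 1)) • X n := by
  rw [laplacian_sum k _ c hX]
  cases N with
  | zero => simp
  | succ N =>
    rw [Finset.sum_range_succ']
    simp [hΔ, prev, smul_smul, mul_comm]

include hX hΔ in
lemma laplacian_iterate_sum_range (m N : ℕ) (c : ℕ → ℂ) :
    (laplacian k)^[m] (∑ n ∈ Finset.range N, c n • X n) =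
      ∑ n ∈ Finset.range (N - m), (κ ^ m * c (n + m)) • X n := by
  induction m generalizing N c with
  | zero => simp
  | succ m ih =>
    rw [Function.iterate_succ_apply, laplacian_sum_range hX hΔ,
      ih (N - 1) fun n => κ * c (n + 1), Nat.sub_sub, add_comm 1 m]
    exact Finset.sum_congr rfl fun n _ => by rw [pow_succ, mul_assoc, add_assoc]

include hκ hX hΔ hX0

lemma coeff_eq_zero_of_sum_range_eq_zero (N : ℕ) (c : ℕ → ℂ)
    (h : ∑ n ∈ Finset.range N, c n • X n = 0) : ∀ n < N, c n = 0 := by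
  induction N generalizing c with
  | zero => simp
  | succ N ih =>
    have hlap : ∑ n ∈ Finset.range N, (κ * c (n + 1)) • X n = 0 := by
      rw [← Nat.add_sub_cancel (n := N) (m := 1), ← laplacian_sum_range hX hΔ, h]
      simpa using laplacian_sum_range hX hΔ 0 c
    have hsucc : ∀ n < N, c (n + 1) = 0 := fun n hn =>
      (mul_eq_zero.1 (ih (fun n => κ * c (n + 1)) hlap n hn)).resolve_left hκ
    rw [Finset.sum_range_succ', Finset.sum_eq_zero fun n hn => by
      rw [hsucc n (Finset.mem_range.1 hn), zero_smul], zero_add] at h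
    rintro (_ | n) hn
    · exact (smul_eq_zero.1 h).resolve_right hX0
    · exact hsucc n (by omega)

lemma linearIndependent_of_tower : LinearIndependent ℂ X := by
  rw [linearIndependent_iff]
  intro c hc
  obtain ⟨N, hN, hsum⟩ := exists_linearCombination_eq_sum_range (X := X) c
  ext n
  by_contra hn
  exact hn (coeff_eq_zero_of_sum_range_eq_zero hκ hX hΔ hX0 N c (hsum ▸ hc) n
    (Finset.mem_range.1 (hN (Finsupp.mem_support_iff.2 hn))))

lemma laplacian_iterate_eq_zero_iff_of_tower {f : ℍ → ℂ}
    (hf : f ∈ Submodule.span ℂ (Set.range X)) (m : ℕ) :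
    (laplacian k)^[m] f = 0 ↔ f ∈ Submodule.span ℂ (Set.range fun j : Fin m => X j) := by
  refine ⟨fun h => ?_, fun h => ?_⟩
  · obtain ⟨N, c, rfl⟩ := exists_sum_range_of_mem_span hf
    rw [laplacian_iterate_sum_range hX hΔ] at h
    have hcoeff := coeff_eq_zero_of_sum_range_eq_zero hκ hX hΔ hX0 _ _ h
    refine sum_mem fun n hn => ?_
    by_cases hnm : n < m
    · exact Submodule.smul_mem _ _ (Submodule.subset_span ⟨⟨n, hnm⟩, rfl⟩)
    · have hcn := hcoeff (n - m) (by have := Finset.mem_range.1 hn; omega)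
      rw [Nat.sub_add_cancel (not_lt.1 hnm)] at hcn
      rw [(mul_eq_zero.1 hcn).resolve_left (pow_ne_zero m hκ), zero_smul]
      exact zero_mem _
  · obtain ⟨c, rfl⟩ := exists_sum_range_of_mem_span_fin h
    simp [laplacian_iterate_sum_range hX hΔ]

end tower

theorem isEisensteinBasis_of_tower {k : ℤ} {κ : ℂ} {X : ℕ → ℍ → ℂ} (hκ : κ ≠ 0)
    (hX : ∀ n, X n ∈ moderateForms k) (hΔ : ∀ n, laplacian k (X n) = κ • prev X n)
    (hX0 : X 0 ≠ 0)
    (hspan : Submodule.span ℂ (Set.range X) = Submodule.span ℂ (Set.range (taylorCoeff k))) :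
    IsEisensteinBasis k X := by
  have hsmooth := fun n => moderateForms_le_smoothFunctions k (hX n)
  have hharmonic {f : ℍ → ℂ} (hf : f ∈ Submodule.span ℂ (Set.range X)) :=
    laplacian_iterate_eq_zero_iff_of_tower hκ hsmooth hΔ hX0 hf
  refine fun m _ => ⟨(linearIndependent_of_tower hκ hsmooth hΔ hX0).comp _ Fin.val_injective,
    Set.ext fun f => ⟨fun hf => ?_,
      fun ⟨hf, hfspan⟩ => (hharmonic (hspan ▸ hfspan) m).1 hf.harmonic⟩⟩
  have hfspan : f ∈ Submodule.span ℂ (Set.range X) :=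
    Submodule.span_mono (Set.range_comp_subset_range Fin.val X) hf
  have hform : f ∈ moderateForms k := Submodule.span_le.2 (Set.range_subset_iff.2 hX) hfspan
  exact ⟨⟨hform.1, hform.2.1, (hharmonic hfspan m).2 hf, hform.2.2⟩, hspan ▸ hfspan⟩

section sequences

variable {X : ℕ → ℍ → ℂ}

lemma prev_apply (X : ℕ → ℍ → ℂ) (n : ℕ) (z : ℍ) : prev X n z = shift (fun n => X n z) n := by
  cases n <;> rfl

lemma prev_add (X Y : ℕ → ℍ → ℂ) : prev (X + Y) = prev X + prev Y := by
  ext n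
  cases n <;> simp [prev]

lemma prev_smul (c : ℂ) (X : ℕ → ℍ → ℂ) : prev (c • X) = c • prev X := by
  ext n
  cases n <;> simp [prev]

lemma prev_mem {S : Submodule ℂ (ℍ → ℂ)} (hX : ∀ n, X n ∈ S) (n : ℕ) : prev X n ∈ S := by
  cases n with
  | zero => exact S.zero_mem
  | succ n => exact hX n

lemma xi_prev (k : ℤ) (X : ℕ → ℍ → ℂ) :
    (fun n => xi k (prev X n)) = prev fun n => xi k (X n) := by
  ext1 n
  cases n with
  | zero => exact xi_zero k
  | succ n => rfl

/-- The sequence `c X_n + κ X_{n-1} + X_{n-2}`: multiplication of the generating series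
`∑ X_n s^n` by the quadratic polynomial `c + κ s + s²`. -/
def quadraticShift (c κ : ℝ) (X : ℕ → ℍ → ℂ) : ℕ → ℍ → ℂ :=
  (c : ℂ) • X + (κ : ℂ) • prev X + prev (prev X)

lemma quadraticShift_mem {S : Submodule ℂ (ℍ → ℂ)} (hX : ∀ n, X n ∈ S) (c κ : ℝ) (n : ℕ) :
    quadraticShift c κ X n ∈ S :=
  add_mem (add_mem (S.smul_mem _ (hX n)) (S.smul_mem _ (prev_mem hX n))) (prev_mem (prev_mem hX) n)

lemma xi_quadraticShift (k : ℤ) (hX : ∀ n, X n ∈ smoothFunctions) (c κ : ℝ) :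
    (fun n => xi k (quadraticShift c κ X n)) = quadraticShift c κ fun n => xi k (X n) := by
  have hX₁ := prev_mem hX
  have hX₂ := prev_mem hX₁
  ext1 n
  simp only [quadraticShift, Pi.add_apply, Pi.smul_apply]
  rw [xi_add k (add_mem (Submodule.smul_mem _ _ (hX n)) (Submodule.smul_mem _ _ (hX₁ n))) (hX₂ n),
    xi_add k (Submodule.smul_mem _ _ (hX n)) (Submodule.smul_mem _ _ (hX₁ n)), xi_smul k (hX n),
    xi_smul k (hX₁ n), conj_ofReal, conj_ofReal, ← xi_prev, ← xi_prev]

/-- The sequence `(-1)^n X_n`, whose generating series is that of `X` at `-s`. -/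
def alternate (X : ℕ → ℍ → ℂ) (n : ℕ) : ℍ → ℂ := (-1 : ℂ) ^ n • X n

lemma alternate_mem {S : Submodule ℂ (ℍ → ℂ)} (hX : ∀ n, X n ∈ S) (n : ℕ) : alternate X n ∈ S :=
  S.smul_mem _ (hX n)

lemma alternate_quadraticShift (c κ : ℝ) (X : ℕ → ℍ → ℂ) :
    alternate (quadraticShift c κ X) = quadraticShift c (-κ) (alternate X) := by
  ext n z
  rcases n with _ | _ | n <;> simp [alternate, quadraticShift, prev] <;> ring

lemma span_range_alternate (X : ℕ → ℍ → ℂ) :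
    Submodule.span ℂ (Set.range (alternate X)) = Submodule.span ℂ (Set.range X) := by
  refine span_range_eq_of_triangular (d := fun n l => if l = 0 then (-1) ^ n else 0)
    (fun n => by simp) fun n => ?_
  simp [alternate]

end sequences

section taylorCoefficients

lemma exists_weight_eq_sub {k : ℤ} (hk : Even k) (hk0 : k ≠ 0) :
    ∃ a b : ℕ, (a = 0 ∨ b = 0) ∧ Even (a + b) ∧ a + b ≠ 0 ∧ k = b - a := by
  obtain ⟨j, rfl⟩ := hk
  exact ⟨(-(j + j)).toNat, (j + j).toNat, by omega, ⟨j.natAbs, by omega⟩, by omega, by omega⟩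

lemma isEntireContinuation_doublyCompleted {k : ℤ} (hk : Even k) (hk0 : k ≠ 0) (z : ℍ) :
    IsEntireContinuation k z (doublyCompleted k z) := by
  obtain ⟨a, b, hab, heven, hne, rfl⟩ := exists_weight_eq_sub hk hk0
  have h := isEntireContinuation_completedTheta hab heven hne z
  rwa [h.doublyCompleted_eq]

lemma taylorCoeff_eq_quadraticShift {a b : ℕ} (hab : a = 0 ∨ b = 0) (heven : Even (a + b))
    (hne : a + b ≠ 0) :
    taylorCoeff ((b : ℤ) - a) =
      quadraticShift (((b : ℝ) - a) / 2 * (((b : ℝ) - a) / 2 - 1)) (b - a - 1)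
        fun n (z : ℍ) => completedCoeff a b n z := by
  ext n z
  have hcoeff : taylorAt (completedTheta a b z) = fun n => completedCoeff a b n z :=
    funext fun n => taylorAt_completedTheta a b n z.im_pos
  have hfactor : (fun s : ℂ => (s + ((b : ℂ) - a) / 2) * (s + ((b : ℂ) - a) / 2 - 1) *
      completedTheta a b z s) = fun s => (((b : ℂ) - a) / 2 * (((b : ℂ) - a) / 2 - 1) +
        (b - a - 1) * s + s * s) * completedTheta a b z s := by
    ext s
    ring
  rw [taylorCoeff_eq_taylorAt,
    (isEntireContinuation_completedTheta hab heven hne z).doublyCompleted_eq, hfactor,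
    taylorAt_quadratic_mul (differentiable_completedTheta a b z.im_pos), hcoeff]
  simp [quadraticShift, prev_apply]

lemma taylorCoeff_mem_moderateForms {k : ℤ} (hk : Even k) (hk0 : k ≠ 0) (n : ℕ) :
    taylorCoeff k n ∈ moderateForms k := by
  obtain ⟨a, b, hab, heven, hne, rfl⟩ := exists_weight_eq_sub hk hk0
  rw [taylorCoeff_eq_quadraticShift hab heven hne]
  exact quadraticShift_mem (completedCoeff_mem_moderateForms a b) _ _ n

lemma xi_alternate_completedCoeff_neg (a : ℕ) :
    (fun n => xi (-(a : ℤ)) (alternate (fun n (z : ℍ) => completedCoeff a 0 n z) n)) =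
      fun n (z : ℍ) => completedCoeff 0 (a + 2) n z := by
  ext n z
  have hmem := completedCoeff_mem_moderateForms a 0 n
  rw [alternate, xi_smul _ (moderateForms_le_smoothFunctions _ hmem), Pi.smul_apply,
    xi_completedCoeff_neg, smul_eq_mul, ← mul_assoc]
  simp [← mul_pow]

variable {a : ℕ} (ha : Even a) (ha0 : a ≠ 0)

include ha in
lemma taylorCoeff_pos :
    taylorCoeff ((a + 2 : ℕ) : ℤ) = quadraticShift (a / 2 * (a / 2 + 1)) (a + 1)
      fun n (z : ℍ) => completedCoeff 0 (a + 2) n z := by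
  have h := taylorCoeff_eq_quadraticShift (a := 0) (b := a + 2) (Or.inl rfl)
    (by simpa using ha.add even_two) (by omega)
  rw [Nat.cast_zero, sub_zero] at h
  rw [h]
  congr 1 <;> push_cast <;> ring

include ha ha0

lemma alternate_taylorCoeff_neg :
    alternate (taylorCoeff (-(a : ℤ))) = quadraticShift (a / 2 * (a / 2 + 1)) (a + 1)
      (alternate fun n (z : ℍ) => completedCoeff a 0 n z) := by
  have h := taylorCoeff_eq_quadraticShift (a := a) (b := 0) (Or.inr rfl) ha ha0
  rw [Nat.cast_zero, zero_sub] at h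
  rw [h, alternate_quadraticShift]
  congr 1 <;> push_cast <;> ring

lemma xi_alternate_taylorCoeff_neg (n : ℕ) :
    xi (-(a : ℤ)) (alternate (taylorCoeff (-(a : ℤ))) n) = taylorCoeff ((a + 2 : ℕ) : ℤ) n := by
  rw [alternate_taylorCoeff_neg ha ha0, taylorCoeff_pos ha, ← xi_alternate_completedCoeff_neg,
    ← xi_quadraticShift _ (alternate_mem fun n =>
      moderateForms_le_smoothFunctions _ (completedCoeff_mem_moderateForms a 0 n))]

lemma xi_taylorCoeff_pos (n : ℕ) :
    xi ((a + 2 : ℕ) : ℤ) (taylorCoeff ((a + 2 : ℕ) : ℤ) n) =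
      ((a + 1 : ℝ) : ℂ) • prev (alternate (taylorCoeff (-(a : ℤ)))) n +
        prev (prev (alternate (taylorCoeff (-(a : ℤ))))) n := by
  have hxi : (fun n => xi ((a + 2 : ℕ) : ℤ) fun z : ℍ => completedCoeff 0 (a + 2) n z) =
      ((a + 1 : ℝ) : ℂ) • prev (alternate fun n (z : ℍ) => completedCoeff a 0 n z) +
        prev (prev (alternate fun n (z : ℍ) => completedCoeff a 0 n z)) := by
    ext n z
    rw [xi_completedCoeff_pos ha ha0]
    simp [prev_apply, alternate]
  have hmem (n : ℕ) :=
    moderateForms_le_smoothFunctions _ (completedCoeff_mem_moderateForms 0 (a + 2) n)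
  rw [taylorCoeff_pos ha, alternate_taylorCoeff_neg ha ha0]
  refine (congrFun (xi_quadraticShift _ hmem _ _) n).trans ?_
  rw [hxi]
  simp only [quadraticShift, prev_add, prev_smul, Pi.add_apply, Pi.smul_apply]
  module

end taylorCoefficients

section modified

/-- The coefficients `(-1)^ℓ κ^{-ℓ} C(n+ℓ, n)` of the modified Taylor coefficients. -/
def modifiedCoeff (κ : ℂ) (n l : ℕ) : ℂ := (-1) ^ l * (1 / κ ^ l) * ((n + l).choose n : ℂ)

/-- The sequence `∑_{ℓ ≤ n} (-1)^ℓ κ^{-ℓ} C(n+ℓ, n) X_{n-ℓ}`, the common form of `modifiedG` and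
`modifiedF`. -/
def modified (κ : ℂ) (X : ℕ → ℍ → ℂ) (n : ℕ) : ℍ → ℂ :=
  ∑ l ∈ Finset.range (n + 1), modifiedCoeff κ n l • X (n - l)

lemma modifiedG_eq_modified (k : ℤ) : modifiedG k = modified ((k : ℂ) - 1) (taylorCoeff k) := by
  ext n z
  simp [modifiedG, modified, modifiedCoeff]

lemma modifiedF_eq_modified (k : ℤ) :
    modifiedF k = modified ((k : ℂ) - 1) (alternate (taylorCoeff (2 - k))) := by
  ext n z
  simp only [modifiedF, modified, modifiedCoeff, alternate, Finset.mul_sum, Finset.sum_apply,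
    Pi.smul_apply, smul_eq_mul]
  refine Finset.sum_congr rfl fun l hl => ?_
  have hsign : (-1 : ℂ) ^ n = (-1) ^ (n - l) * (-1) ^ l := by
    rw [← pow_add, Nat.sub_add_cancel (Nat.lt_succ_iff.1 (Finset.mem_range.1 hl))]
  rw [hsign]
  ring

lemma modifiedCoeff_zero (κ : ℂ) (n : ℕ) : modifiedCoeff κ n 0 = 1 := by
  simp [modifiedCoeff]

lemma modified_zero (κ : ℂ) (X : ℕ → ℍ → ℂ) : modified κ X 0 = X 0 := by
  simp [modified, modifiedCoeff_zero]

lemma modified_mem {S : Submodule ℂ (ℍ → ℂ)} {X : ℕ → ℍ → ℂ} (hX : ∀ n, X n ∈ S) (κ : ℂ) (n : ℕ) :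
    modified κ X n ∈ S :=
  sum_mem fun _ _ => S.smul_mem _ (hX _)

lemma span_range_modified (κ : ℂ) (X : ℕ → ℍ → ℂ) :
    Submodule.span ℂ (Set.range (modified κ X)) = Submodule.span ℂ (Set.range X) :=
  span_range_eq_of_triangular (d := modifiedCoeff κ) (fun n => by simp [modifiedCoeff_zero])
    fun _ => rfl

lemma xi_modified (k : ℤ) {X : ℕ → ℍ → ℂ} (hX : ∀ n, X n ∈ smoothFunctions) (κ : ℝ) :
    (fun n => xi k (modified κ X n)) = modified κ fun n => xi k (X n) := by
  ext1 n
  rw [modified, xi_sum k _ (modifiedCoeff κ n) (X := fun l => X (n - l)) fun l => hX _]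
  simp [modified, modifiedCoeff]

lemma mul_modifiedCoeff_succ_succ_add {κ : ℂ} (hκ : κ ≠ 0) (n l : ℕ) :
    κ * modifiedCoeff κ (n + 1) (l + 1) + modifiedCoeff κ (n + 1) l =
      κ * modifiedCoeff κ n (l + 1) := by
  have hpascal : ((n + 1 + (l + 1)).choose (n + 1) : ℂ) =
      (n + (l + 1)).choose n + (n + 1 + l).choose (n + 1) := by
    rw [← Nat.cast_add, show n + 1 + (l + 1) = n + (l + 1) + 1 by ring, Nat.choose_succ_succ,
      show n + (l + 1) = n + 1 + l by ring]
  rw [modifiedCoeff, modifiedCoeff, modifiedCoeff, hpascal]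
  field_simp
  ring

lemma modified_succ_prev (κ : ℂ) (X : ℕ → ℍ → ℂ) (n : ℕ) :
    modified κ (prev X) (n + 1) =
      ∑ l ∈ Finset.range (n + 1), modifiedCoeff κ (n + 1) l • X (n - l) := by
  rw [modified, Finset.sum_range_succ, Nat.sub_self, prev, smul_zero, add_zero]
  refine Finset.sum_congr rfl fun l hl => ?_
  rw [Nat.succ_sub (Nat.lt_succ_iff.1 (Finset.mem_range.1 hl)), prev]

lemma modified_smul_prev_add_prev_prev {κ : ℂ} (hκ : κ ≠ 0) (X : ℕ → ℍ → ℂ) (n : ℕ) :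
    modified κ (κ • prev X + prev (prev X)) n = κ • prev (modified κ X) n := by
  cases n with
  | zero => simp [modified, prev]
  | succ n =>
    have hprev : prev (κ • X + prev X) = κ • prev X + prev (prev X) := by
      rw [prev_add, prev_smul]
    have hshift : ∑ l ∈ Finset.range (n + 1), modifiedCoeff κ (n + 1) l • prev X (n - l) =
        ∑ l ∈ Finset.range n, modifiedCoeff κ (n + 1) l • X (n - (l + 1)) := by
      rw [Finset.sum_range_succ, Nat.sub_self, prev, smul_zero, add_zero]
      refine Finset.sum_congr rfl fun l hl => ?_
      rw [show n - l = n - (l + 1) + 1 by have := Finset.mem_range.1 hl; omega, prev]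
    rw [← hprev, modified_succ_prev]
    simp only [Pi.add_apply, Pi.smul_apply, smul_add, Finset.sum_add_distrib]
    rw [hshift, Finset.sum_range_succ', add_right_comm, ← Finset.sum_add_distrib]
    simp only [smul_smul, ← add_smul, mul_comm _ κ, mul_modifiedCoeff_succ_succ_add hκ]
    rw [prev, modified, Finset.sum_range_succ' _ n, smul_add, Finset.smul_sum,
      modifiedCoeff_zero, modifiedCoeff_zero]
    simp only [smul_smul, mul_one]

end modified

theorem isModifiedBasis_of_ramp {k : ℤ} {G F : ℕ → ℍ → ℂ} (hk : k ≠ 1)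
    (hG : ∀ n, G n ∈ moderateForms k) (hF : ∀ n, F n ∈ moderateForms (2 - k))
    (hGF : ∀ n, xi k (G n) = ((k : ℂ) - 1) • prev F n) (hFG : ∀ n, xi (2 - k) (F n) = G n)
    (hG0 : G 0 ≠ 0)
    (hGspan : Submodule.span ℂ (Set.range G) = Submodule.span ℂ (Set.range (taylorCoeff k)))
    (hFspan : Submodule.span ℂ (Set.range F) = Submodule.span ℂ (Set.range (taylorCoeff (2 - k)))) :
    IsModifiedBasis k G F := by
  have hGsmooth := fun n => moderateForms_le_smoothFunctions _ (hG n)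
  have hFsmooth := fun n => moderateForms_le_smoothFunctions _ (hF n)
  have hκ : (k : ℂ) - 1 ≠ 0 := sub_ne_zero.2 (by exact_mod_cast hk)
  have hGΔ : ∀ n, laplacian k (G n) = ((k : ℂ) - 1) • prev G n := fun n => by
    rw [laplacian_eq_xi_xi k (hGsmooth n), hGF, xi_smul _ (prev_mem hFsmooth n),
      congrFun (xi_prev (2 - k) F) n, funext hFG]
    simp
  have hFΔ : ∀ n, laplacian (2 - k) (F n) = ((k : ℂ) - 1) • prev F n := fun n => by
    rw [laplacian_eq_xi_xi _ (hFsmooth n), hFG, sub_sub_cancel, hGF]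
  have hF0 : F 0 ≠ 0 := fun h => hG0 (by rw [← hFG, h, xi_zero])
  exact ⟨isEisensteinBasis_of_tower hκ hG hGΔ hG0 hGspan,
    isEisensteinBasis_of_tower hκ hF hFΔ hF0 hFspan, hGF, hFG, hGΔ, hFΔ⟩

section nonvanishing

lemma eisensteinSeries_apply_zero {b : ℕ} (hb3 : 3 ≤ b) (z : ℍ) :
    eisensteinSeries (b : ℤ) z 0 = riemannZeta b * ModularForm.E hb3 z := by
  have hE : ModularForm.E hb3 z = 1 / 2 * _root_.eisensteinSeries (N := 1) 0 b z := rfl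
  have hsupport : (Function.support fun p : ℤ × ℤ =>
      EisensteinSeries.eisSummand b ((finTwoArrowEquiv ℤ).symm p) z) ⊆ {p | p ≠ 0} := by
    rintro p hp rfl
    simp [EisensteinSeries.eisSummand, show b ≠ 0 by omega] at hp
  rw [hE, mul_left_comm, ← tsum_eisSummand_eq_riemannZeta_mul_eisensteinSeries hb3,
    ← (finTwoArrowEquiv ℤ).symm.tsum_eq, ← tsum_subtype_eq_of_support_subset hsupport,
    eisensteinSeries]
  congr 1
  exact tsum_congr fun p => by simp [EisensteinSeries.eisSummand]

lemma exists_eisensteinSeries_apply_zero_ne_zero {b : ℕ} (hb : Even b) (hb3 : 3 ≤ b) :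
    ∃ z : ℍ, eisensteinSeries (b : ℤ) z 0 ≠ 0 := by
  by_contra! h
  have hzeta : riemannZeta b ≠ 0 := riemannZeta_ne_zero_of_one_lt_re (by
    rw [natCast_re]
    exact_mod_cast (by omega : 1 < b))
  refine EisensteinSeries.E_ne_zero hb3 hb (ModularForm.ext fun z => ?_)
  exact (mul_eq_zero.1 ((eisensteinSeries_apply_zero hb3 z).symm.trans (h z))).resolve_left hzeta

lemma taylorCoeff_zero_ne_zero {b : ℕ} (hb : Even b) (hb3 : 3 ≤ b) :
    taylorCoeff (b : ℤ) 0 ≠ 0 := by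
  obtain ⟨z, hz⟩ := exists_eisensteinSeries_apply_zero_ne_zero hb hb3
  have hb3' : (3 : ℝ) ≤ b := by exact_mod_cast hb3
  have hcont := isEntireContinuation_doublyCompleted (k := b) (by exact_mod_cast hb) (by omega) z
  have hvalue : taylorCoeff (b : ℤ) 0 z = doublyCompletedSeries b z 0 := by
    rw [taylorCoeff, iteratedDeriv_zero, Nat.factorial_zero, Nat.cast_one, div_one]
    exact hcont.2 0 (by rw [zero_re]; push_cast; linarith)
  have hb0 : (b : ℂ) ≠ 0 := Nat.cast_ne_zero.2 (by omega)
  have hb2 : (b : ℂ) / 2 - 1 ≠ 0 := fun h =>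
    (by omega : b ≠ 2) (by exact_mod_cast (by linear_combination 2 * h : (b : ℂ) = 2))
  have hgamma : Complex.Gamma b ≠ 0 :=
    Complex.Gamma_ne_zero_of_re_pos (by rw [natCast_re]; linarith)
  have hpi : (Real.pi : ℂ) ^ (-((b : ℂ) / 2)) ≠ 0 := by
    simp [cpow_eq_zero_iff, Real.pi_ne_zero]
  intro h
  rw [h, doublyCompletedSeries] at hvalue
  simp [hb0, hb2, hgamma, hpi, hz] at hvalue

end nonvanishing

theorem isModifiedBasis_modifiedG_modifiedF {k : ℤ} (hk : Even k) (hk4 : 4 ≤ k) :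
    IsModifiedBasis k (modifiedG k) (modifiedF k) := by
  obtain ⟨a, hka⟩ : ∃ a : ℕ, k = ((a + 2 : ℕ) : ℤ) := ⟨(k - 2).toNat, by omega⟩
  have ha : Even a := by
    subst hka
    simpa [parity_simps] using hk
  have ha0 : a ≠ 0 := by omega
  have h2k : 2 - k = -(a : ℤ) := by omega
  have hκ : (k : ℂ) - 1 = ((a + 1 : ℝ) : ℂ) := by
    rw [hka]
    push_cast
    ring
  have hκ0 : ((a + 1 : ℝ) : ℂ) ≠ 0 := by exact_mod_cast a.succ_ne_zero
  have hG := taylorCoeff_mem_moderateForms hk (by omega)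
  have hF := alternate_mem (taylorCoeff_mem_moderateForms (even_two.sub hk) (by omega))
  rw [modifiedG_eq_modified, modifiedF_eq_modified]
  refine isModifiedBasis_of_ramp (by omega) (modified_mem hG _) (modified_mem hF _)
    (fun n => ?_) (fun n => ?_) ?_ (span_range_modified _ _)
    ((span_range_modified _ _).trans (span_range_alternate _))
  · rw [hκ, congrFun (xi_modified k (fun n => moderateForms_le_smoothFunctions _ (hG n)) _) n,
      ← modified_smul_prev_add_prev_prev hκ0]
    congr 1
    ext1 n
    rw [h2k, hka, xi_taylorCoeff_pos ha ha0]
    rfl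
  · rw [hκ, congrFun (xi_modified _ (fun n => moderateForms_le_smoothFunctions _ (hF n)) _) n]
    congr 1
    ext1 n
    rw [h2k, hka, xi_alternate_taylorCoeff_neg ha ha0]
  · rw [modified_zero, hka]
    exact taylorCoeff_zero_ne_zero (ha.add even_two) (by omega)

end PolyharmonicMaass

end

theorem theorem2 (k : ℤ) (hk : Even k) (hk4 : 4 ≤ k) :
    (∀ z : UpperHalfPlane,
      PolyharmonicMaass.IsEntireContinuation k z (PolyharmonicMaass.doublyCompleted k z) ∧
      PolyharmonicMaass.IsEntireContinuation (2 - k) z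
        (PolyharmonicMaass.doublyCompleted (2 - k) z)) ∧
    (∃ G F : ℕ → UpperHalfPlane → ℂ, PolyharmonicMaass.IsModifiedBasis k G F) ∧
    PolyharmonicMaass.IsModifiedBasis k
      (PolyharmonicMaass.modifiedG k) (PolyharmonicMaass.modifiedF k) := by
  have hbasis := PolyharmonicMaass.isModifiedBasis_modifiedG_modifiedF hk hk4
  exact ⟨fun z => ⟨PolyharmonicMaass.isEntireContinuation_doublyCompleted hk (by omega) z,
    PolyharmonicMaass.isEntireContinuation_doublyCompleted (even_two.sub hk) (by omega) z⟩,
    ⟨_, _, hbasis⟩, hbasis⟩
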